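/- Let $G$ be a second-countable compact (Hausdorff) group, let $A$ be a $\sigma$-unital (not necessarily unital) $C^*$-algebra, and let $\alpha\colon G\to\mathrm{Aut}(A)$ be an action such that $g\mapsto\alpha_g(a)$ is continuous for every $a\in A$. Write $A^\alpha=\{a\in A:\alpha_g(a)=a\text{ for all }g\in G\}$. Let $A_\infty=\ell^\infty(\mathbb{N},A)/c_0(\mathbb{N},A)$, with quotient map $\eta$, and regard $A\subseteq A_\infty$ via constant sequences. For an $\alpha$-invariant $C^*$-subalgebra $D\subseteq A$ put $$F(D,A)=(A_\infty\cap D')/\mathrm{Ann}(D,A_\infty),\qquad \mathrm{Ann}(D,A_\infty)=\{x\in A_\infty : xd=dx=0\text{ for all }d\in D\},$$ with quotient map $\kappa$, and let $F(\alpha)$ be the action of $G$ on $F(D,A)$ induced by applying $\alpha$ termwise. Let $A_{\infty,\alpha}$ be the image under $\eta$ of the set of bounded sequences $(a_n)_n$ for which $g\mapsto(\alpha_g(a_n))_n$ is continuous in the supremum norm, and let $F_\alpha(D,A)=\kappa(A_{\infty,\alpha}\cap D')$. Assume that $\alpha$ has the Rokhlin property: for every separable $\alpha$-invariant $C^*$-subalgebra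 $D\subseteq A$ there is a unital $*$-homomorphism $\varphi\colon C(G)\to F_\alpha(D,A)$ with $\varphi(\mathrm{Lt}_g(f))=F(\alpha)_g(\varphi(f))$ for all $g\in G$ and $f\in C(G)$, where $\mathrm{Lt}_g(f)(h)=f(g^{-1}h)$. Then for every compact subset $F_1\subseteq A$, every compact subset $F_2\subseteq A^\alpha$ and every $\varepsilon>0$ there is a completely positive contractive linear map $\psi\colon A\to A^\alpha$ such that 1. $\|\psi(ab)-\psi(a)\psi(b)\|<\varepsilon$ for all $a,b\in F_1$; 2. $\|\psi(a)-a\|<\varepsilon$ for all $a\in F_2$. Moreover, if $A$ is unital, then $\psi$ can be chosen so that $\psi(1)=1$. In particular, when $A$ is separable, there is a sequence $(\psi_n)_{n\in\mathbb{N}}$ of completely positive contractive linear maps $\psi_n\colon A\to A^\alpha$, which can be chosen unital if $A$ is unital, that is an approximate homomorphism, meaning $\lim_n\|\psi_n(ab)-\psi_n(a)\psi_n(b)\|=0$ and $\lim_n\|\psi_n(a^*)-\psi_n(a)^*\|=0$ for all $a,b\in A$, and that satisfies $\lim_n\|\psi_n(a)-a\|=0$ for all $a\in A^\alpha$. -/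

import Mathlib

open Filter Topology
open scoped CStarAlgebra

noncomputable section

namespace RokhlinAction

/-! ### Quotients of star algebras by two-sided, self-adjoint ideals

Homomorphisms between C⋆-algebras are the ⋆-homomorphisms (they are automatically continuous), so
only the ⋆-algebra structure of the quotient is recorded. -/

/-- A self-adjoint two-sided ideal of a (not necessarily unital) complex star algebra. -/
structure StarIdeal (B : Type*) [NonUnitalRing B] [StarRing B] [Module ℂ B]
    extends Submodule ℂ B where
  mul_mem_left' : ∀ (b : B) {x : B}, x ∈ carrier → b * x ∈ carrier
  mul_mem_right' : ∀ (b : B) {x : B}, x ∈ carrier → x * b ∈ carrier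
  star_mem' : ∀ {x : B}, x ∈ carrier → star x ∈ carrier

namespace StarIdeal

variable {B : Type*} [NonUnitalRing B] [StarRing B] [Module ℂ B] (I : StarIdeal B)

/-- The quotient of a star algebra by a self-adjoint two-sided ideal. -/
def Quotient : Type _ := B ⧸ I.toSubmodule

instance : AddCommGroup I.Quotient := inferInstanceAs (AddCommGroup (B ⧸ I.toSubmodule))

instance : Module ℂ I.Quotient := inferInstanceAs (Module ℂ (B ⧸ I.toSubmodule))

/-- The class of an element in the quotient. -/
def cls (b : B) : I.Quotient := Submodule.Quotient.mk (p := I.toSubmodule) b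

theorem cls_surjective : Function.Surjective I.cls :=
  Submodule.Quotient.mk_surjective I.toSubmodule

theorem cls_eq_iff {a b : B} : I.cls a = I.cls b ↔ a - b ∈ I.toSubmodule :=
  Submodule.Quotient.eq I.toSubmodule

instance : Mul I.Quotient where
  mul := Quotient.map₂ (· * ·) (by
    intro a a' ha b b' hb
    have ha' : a - a' ∈ I.toSubmodule := (Submodule.quotientRel_def _).1 ha
    have hb' : b - b' ∈ I.toSubmodule := (Submodule.quotientRel_def _).1 hb
    refine (Submodule.quotientRel_def _).2 ?_
    have h : a * b - a' * b' = (a - a') * b + a' * (b - b') := by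
      rw [sub_mul, mul_sub]; abel
    show a * b - a' * b' ∈ I.toSubmodule
    rw [h]
    exact I.toSubmodule.add_mem (I.mul_mem_right' b ha') (I.mul_mem_left' a' hb'))

instance : Star I.Quotient where
  star := Quotient.map star (by
    intro a a' ha
    have ha' : a - a' ∈ I.toSubmodule := (Submodule.quotientRel_def _).1 ha
    refine (Submodule.quotientRel_def _).2 ?_
    rw [← star_sub]
    exact I.star_mem' ha')

theorem cls_zero : I.cls 0 = 0 := rfl

theorem cls_add (a b : B) : I.cls (a + b) = I.cls a + I.cls b := rfl

theorem cls_mul (a b : B) : I.cls (a * b) = I.cls a * I.cls b := rfl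

theorem cls_star (a : B) : I.cls (star a) = star (I.cls a) := rfl

theorem cls_smul (c : ℂ) (a : B) : I.cls (c • a) = c • I.cls a := rfl

instance : NonUnitalRing I.Quotient where
  left_distrib x y z := by
    obtain ⟨a, rfl⟩ := I.cls_surjective x
    obtain ⟨b, rfl⟩ := I.cls_surjective y
    obtain ⟨c, rfl⟩ := I.cls_surjective z
    simp only [← cls_add, ← cls_mul, mul_add]
  right_distrib x y z := by
    obtain ⟨a, rfl⟩ := I.cls_surjective x
    obtain ⟨b, rfl⟩ := I.cls_surjective y
    obtain ⟨c, rfl⟩ := I.cls_surjective z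
    simp only [← cls_add, ← cls_mul, add_mul]
  zero_mul x := by
    obtain ⟨a, rfl⟩ := I.cls_surjective x
    rw [← cls_zero, ← cls_mul, zero_mul]
  mul_zero x := by
    obtain ⟨a, rfl⟩ := I.cls_surjective x
    rw [← cls_zero, ← cls_mul, mul_zero]
  mul_assoc x y z := by
    obtain ⟨a, rfl⟩ := I.cls_surjective x
    obtain ⟨b, rfl⟩ := I.cls_surjective y
    obtain ⟨c, rfl⟩ := I.cls_surjective z
    simp only [← cls_mul, mul_assoc]

instance : StarRing I.Quotient where
  star_involutive x := by
    obtain ⟨a, rfl⟩ := I.cls_surjective x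
    simp only [← cls_star, star_star]
  star_mul x y := by
    obtain ⟨a, rfl⟩ := I.cls_surjective x
    obtain ⟨b, rfl⟩ := I.cls_surjective y
    simp only [← cls_star, ← cls_mul, star_mul]
  star_add x y := by
    obtain ⟨a, rfl⟩ := I.cls_surjective x
    obtain ⟨b, rfl⟩ := I.cls_surjective y
    simp only [← cls_star, ← cls_add, star_add]

instance [IsScalarTower ℂ B B] : IsScalarTower ℂ I.Quotient I.Quotient where
  smul_assoc c x y := by
    obtain ⟨a, rfl⟩ := I.cls_surjective x
    obtain ⟨b, rfl⟩ := I.cls_surjective y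
    simp only [smul_eq_mul, ← cls_smul, ← cls_mul, smul_mul_assoc]

instance [SMulCommClass ℂ B B] : SMulCommClass ℂ I.Quotient I.Quotient where
  smul_comm c x y := by
    obtain ⟨a, rfl⟩ := I.cls_surjective x
    obtain ⟨b, rfl⟩ := I.cls_surjective y
    simp only [smul_eq_mul, ← cls_smul, ← cls_mul, mul_smul_comm]

instance [StarModule ℂ B] : StarModule ℂ I.Quotient where
  star_smul c x := by
    obtain ⟨a, rfl⟩ := I.cls_surjective x
    simp only [← cls_smul, ← cls_star, star_smul]

/-- The quotient map, as a ⋆-homomorphism. -/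
def proj : B →⋆ₙₐ[ℂ] I.Quotient where
  toFun := I.cls
  map_smul' _ _ := rfl
  map_zero' := rfl
  map_add' _ _ := rfl
  map_mul' _ _ := rfl
  map_star' _ := rfl

theorem proj_surjective : Function.Surjective I.proj := I.cls_surjective

theorem proj_eq_zero_iff {b : B} : I.proj b = 0 ↔ b ∈ I.toSubmodule :=
  Submodule.Quotient.mk_eq_zero I.toSubmodule

/-- The ⋆-homomorphism induced on quotients by a ⋆-homomorphism which maps one ideal into the
other. -/
def map {C : Type*} [NonUnitalRing C] [StarRing C] [Module ℂ C] (J : StarIdeal C)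
    (f : B →⋆ₙₐ[ℂ] C) (hf : ∀ b ∈ I.toSubmodule, f b ∈ J.toSubmodule) :
    I.Quotient →⋆ₙₐ[ℂ] J.Quotient where
  toFun := Quotient.map f (by
    intro a a' ha
    have ha' : a - a' ∈ I.toSubmodule := (Submodule.quotientRel_def _).1 ha
    refine (Submodule.quotientRel_def _).2 ?_
    rw [← map_sub]
    exact hf _ ha')
  map_smul' c x := by
    obtain ⟨a, rfl⟩ := I.cls_surjective x
    exact congrArg J.cls (map_smul f c a)
  map_zero' := congrArg J.cls (map_zero f)
  map_add' x y := by
    obtain ⟨a, rfl⟩ := I.cls_surjective x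
    obtain ⟨b, rfl⟩ := I.cls_surjective y
    exact congrArg J.cls (map_add f a b)
  map_mul' x y := by
    obtain ⟨a, rfl⟩ := I.cls_surjective x
    obtain ⟨b, rfl⟩ := I.cls_surjective y
    exact congrArg J.cls (map_mul f a b)
  map_star' x := by
    obtain ⟨a, rfl⟩ := I.cls_surjective x
    exact congrArg J.cls (map_star f a)

theorem map_proj {C : Type*} [NonUnitalRing C] [StarRing C] [Module ℂ C] (J : StarIdeal C)
    (f : B →⋆ₙₐ[ℂ] C) (hf : ∀ b ∈ I.toSubmodule, f b ∈ J.toSubmodule) (b : B) :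
    I.map J f hf (I.proj b) = J.proj (f b) := rfl

end StarIdeal

/-! ### Sequence algebras -/

section SequenceAlgebra

variable (A : Type*) [NonUnitalCStarAlgebra A]

/-- The C⋆-algebra `ℓ^∞(ℕ, A)` of bounded sequences in `A`, with the supremum norm. -/
abbrev BddSeq : Type _ := lp (fun _ : ℕ => A) ⊤

variable {A} in
theorem memℓp_top_of_norm_le {f : ℕ → A} {C : ℝ} (h : ∀ n, ‖f n‖ ≤ C) :
    Memℓp f ⊤ :=
  memℓp_infty ⟨C, by rintro _ ⟨n, rfl⟩; exact h n⟩

/-- The ideal `c₀(ℕ, A)` of sequences converging to zero in norm. -/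
def nullSeq : StarIdeal (BddSeq A) where
  carrier := {a | Tendsto (fun n => ‖a n‖) atTop (𝓝 0)}
  zero_mem' := by simp
  add_mem' := by
    intro a b ha hb
    simp only [Set.mem_ofPred_eq, ← tendsto_zero_iff_norm_tendsto_zero] at ha hb ⊢
    have h := ha.add hb
    rw [add_zero] at h
    exact h
  smul_mem' := by
    intro c a ha
    simp only [Set.mem_ofPred_eq, ← tendsto_zero_iff_norm_tendsto_zero] at ha ⊢
    have h := ha.const_smul c
    rw [smul_zero] at h
    exact h
  mul_mem_left' := by
    intro b a ha
    refine squeeze_zero (fun n => norm_nonneg _) (fun n => ?_)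
      (by simpa using Tendsto.const_mul ‖b‖ ha)
    exact (norm_mul_le (b n) (a n)).trans
      (mul_le_mul_of_nonneg_right (lp.norm_apply_le_norm ENNReal.top_ne_zero b n) (norm_nonneg _))
  mul_mem_right' := by
    intro b a ha
    refine squeeze_zero (fun n => norm_nonneg _) (fun n => ?_)
      (by simpa using Tendsto.mul_const ‖b‖ ha)
    exact (norm_mul_le (a n) (b n)).trans
      (mul_le_mul_of_nonneg_left (lp.norm_apply_le_norm ENNReal.top_ne_zero b n) (norm_nonneg _))
  star_mem' := by
    intro a ha
    simpa using ha

/-- The sequence algebra `A_∞ = ℓ^∞(ℕ, A) / c₀(ℕ, A)`. -/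
abbrev SeqAlg : Type _ := (nullSeq A).Quotient

/-- The quotient map `η_A : ℓ^∞(ℕ, A) → A_∞`. -/
abbrev eta : BddSeq A →⋆ₙₐ[ℂ] SeqAlg A := (nullSeq A).proj

/-- The embedding of `A` in `ℓ^∞(ℕ, A)` by constant sequences. -/
def constSeq : A →⋆ₙₐ[ℂ] BddSeq A where
  toFun a := ⟨fun _ => a, memℓp_top_of_norm_le (fun _ => le_refl ‖a‖)⟩
  map_smul' _ _ := rfl
  map_zero' := rfl
  map_add' _ _ := rfl
  map_mul' _ _ := rfl
  map_star' _ := rfl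

/-- The canonical embedding of `A` in `A_∞`. -/
def incl : A →⋆ₙₐ[ℂ] SeqAlg A := (eta A).comp (constSeq A)

variable {A}

/-- The relative commutant `A_∞ ∩ D'`. -/
def commutant (D : NonUnitalStarSubalgebra ℂ A) : NonUnitalStarSubalgebra ℂ (SeqAlg A) where
  carrier := {x | ∀ d ∈ D, x * incl A d = incl A d * x}
  zero_mem' := by intro d _; rw [zero_mul, mul_zero]
  add_mem' := by
    intro x y hx hy d hd
    rw [add_mul, mul_add, hx d hd, hy d hd]
  mul_mem' := by
    intro x y hx hy d hd
    rw [mul_assoc, hy d hd, ← mul_assoc, hx d hd, mul_assoc]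
  smul_mem' := by
    intro c x hx d hd
    rw [smul_mul_assoc, hx d hd, mul_smul_comm]
  star_mem' := by
    intro x hx d hd
    have h := congrArg star (hx (star d) (star_mem hd))
    simpa only [star_mul, map_star, star_star] using h.symm

/-- The annihilator `Ann(D, A_∞)`: the elements `x` of `A_∞` with `x D = D x = 0`. Such elements
commute with `D`, and they form an ideal of `A_∞ ∩ D'`. -/
def annihilator (D : NonUnitalStarSubalgebra ℂ A) : StarIdeal (commutant D) where
  carrier := {x | ∀ d ∈ D, (x : SeqAlg A) * incl A d = 0 ∧ incl A d * (x : SeqAlg A) = 0}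
  zero_mem' := by
    intro d _
    exact ⟨zero_mul _, mul_zero _⟩
  add_mem' := by
    intro x y hx hy d hd
    constructor
    · show ((x : SeqAlg A) + (y : SeqAlg A)) * incl A d = 0
      rw [add_mul, (hx d hd).1, (hy d hd).1, add_zero]
    · show incl A d * ((x : SeqAlg A) + (y : SeqAlg A)) = 0
      rw [mul_add, (hx d hd).2, (hy d hd).2, add_zero]
  smul_mem' := by
    intro c x hx d hd
    constructor
    · show (c • (x : SeqAlg A)) * incl A d = 0
      rw [smul_mul_assoc, (hx d hd).1, smul_zero]
    · show incl A d * (c • (x : SeqAlg A)) = 0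
      rw [mul_smul_comm, (hx d hd).2, smul_zero]
  mul_mem_left' := by
    intro b x hx d hd
    constructor
    · show ((b : SeqAlg A) * (x : SeqAlg A)) * incl A d = 0
      rw [mul_assoc, (hx d hd).1, mul_zero]
    · show incl A d * ((b : SeqAlg A) * (x : SeqAlg A)) = 0
      rw [← mul_assoc, ← b.2 d hd, mul_assoc, (hx d hd).2, mul_zero]
  mul_mem_right' := by
    intro b x hx d hd
    constructor
    · show ((x : SeqAlg A) * (b : SeqAlg A)) * incl A d = 0
      rw [mul_assoc, b.2 d hd, ← mul_assoc, (hx d hd).1, zero_mul]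
    · show incl A d * ((x : SeqAlg A) * (b : SeqAlg A)) = 0
      rw [← mul_assoc, (hx d hd).2, zero_mul]
  star_mem' := by
    intro x hx d hd
    have h := hx (star d) (star_mem hd)
    constructor
    · have h2 := congrArg star h.2
      rw [star_mul, map_star, star_star, star_zero] at h2
      exact h2
    · have h1 := congrArg star h.1
      rw [star_mul, map_star, star_star, star_zero] at h1
      exact h1

/-- Kirchberg's algebra `F(D, A) = (A_∞ ∩ D') / Ann(D, A_∞)`. -/
abbrev KirchbergAlg (D : NonUnitalStarSubalgebra ℂ A) : Type _ := (annihilator D).Quotient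

/-- The quotient map `κ_{D,A} : A_∞ ∩ D' → F(D, A)`. -/
abbrev kappa (D : NonUnitalStarSubalgebra ℂ A) : commutant D →⋆ₙₐ[ℂ] KirchbergAlg D :=
  (annihilator D).proj

end SequenceAlgebra

/-! ### Induced actions -/

section Action

variable {G : Type*} [Group G] {A : Type*} [NonUnitalCStarAlgebra A]

/-- The induced action `α^∞` on `ℓ^∞(ℕ, A)`, applied termwise. -/
def actBddSeq (α : G →* (A ≃⋆ₐ[ℂ] A)) (g : G) : BddSeq A →⋆ₙₐ[ℂ] BddSeq A where
  toFun a := ⟨fun n => α g (a n), memℓp_top_of_norm_le (C := ‖a‖) (fun n =>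
    (NonUnitalStarAlgHom.norm_apply_le (α g) (a n)).trans
      (lp.norm_apply_le_norm ENNReal.top_ne_zero a n))⟩
  map_smul' c a := by ext n; exact map_smul (α g) c (a n)
  map_zero' := by ext n; exact map_zero (α g)
  map_add' a b := by ext n; exact map_add (α g) (a n) (b n)
  map_mul' a b := by ext n; exact map_mul (α g) (a n) (b n)
  map_star' a := by ext n; exact map_star (α g) (a n)

/-- The induced action `α_∞` on `A_∞`. -/
def actSeqAlg (α : G →* (A ≃⋆ₐ[ℂ] A)) (g : G) : SeqAlg A →⋆ₙₐ[ℂ] SeqAlg A :=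
  (nullSeq A).map (nullSeq A) (actBddSeq α g) (by
    intro a ha
    refine squeeze_zero (fun n => norm_nonneg _) (fun n => ?_) ha
    exact NonUnitalStarAlgHom.norm_apply_le (α g) (a n))

theorem actSeqAlg_incl (α : G →* (A ≃⋆ₐ[ℂ] A)) (g : G) (a : A) :
    actSeqAlg α g (incl A a) = incl A (α g a) := rfl

theorem incl_eq_actSeqAlg (α : G →* (A ≃⋆ₐ[ℂ] A)) (g : G) (a : A) :
    incl A a = actSeqAlg α g (incl A (α g⁻¹ a)) := by
  rw [actSeqAlg_incl, ← StarAlgEquiv.mul_apply, ← map_mul, mul_inv_cancel, map_one]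
  rfl

/-- The restriction of `α_∞` to `A_∞ ∩ D'`, for an invariant subalgebra `D`. -/
def actCommutant (α : G →* (A ≃⋆ₐ[ℂ] A)) (D : NonUnitalStarSubalgebra ℂ A)
    (hD : ∀ g, ∀ d ∈ D, α g d ∈ D) (g : G) : commutant D →⋆ₙₐ[ℂ] commutant D :=
  NonUnitalStarAlgHom.codRestrict ((actSeqAlg α g).comp (NonUnitalStarSubalgebraClass.subtype _))
    (commutant D) (by
      intro x d hd
      show actSeqAlg α g (x : SeqAlg A) * incl A d = incl A d * actSeqAlg α g (x : SeqAlg A)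
      rw [incl_eq_actSeqAlg α g d, ← map_mul, ← map_mul, x.2 _ (hD g⁻¹ d hd)])

/-- The induced action `F(α)` on `F(D, A)`, for an invariant subalgebra `D`. -/
def actKirchbergAlg (α : G →* (A ≃⋆ₐ[ℂ] A)) (D : NonUnitalStarSubalgebra ℂ A)
    (hD : ∀ g, ∀ d ∈ D, α g d ∈ D) (g : G) : KirchbergAlg D →⋆ₙₐ[ℂ] KirchbergAlg D :=
  (annihilator D).map (annihilator D) (actCommutant α D hD g) (by
    intro x hx d hd
    have h := hx _ (hD g⁻¹ d hd)
    constructor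
    · show actSeqAlg α g (x : SeqAlg A) * incl A d = 0
      rw [incl_eq_actSeqAlg α g d, ← map_mul, h.1, map_zero]
    · show incl A d * actSeqAlg α g (x : SeqAlg A) = 0
      rw [incl_eq_actSeqAlg α g d, ← map_mul, h.2, map_zero])

variable [TopologicalSpace G]

/-- The algebra `ℓ^∞_α(ℕ, A)` of bounded sequences `a` for which `g ↦ α^∞_g(a)` is norm
continuous. -/
def contBddSeq (α : G →* (A ≃⋆ₐ[ℂ] A)) : NonUnitalStarSubalgebra ℂ (BddSeq A) where
  carrier := {a | Continuous fun g => actBddSeq α g a}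
  zero_mem' := by simpa using continuous_const
  add_mem' := by
    intro a b ha hb
    simp only [Set.mem_ofPred_eq, map_add] at ha hb ⊢
    exact Continuous.add ha hb
  mul_mem' := by
    intro a b ha hb
    simp only [Set.mem_ofPred_eq, map_mul] at ha hb ⊢
    exact Continuous.mul ha hb
  smul_mem' := by
    intro c a ha
    simp only [Set.mem_ofPred_eq, map_smul] at ha ⊢
    exact Continuous.const_smul ha c
  star_mem' := by
    intro a ha
    simpa only [Set.mem_ofPred_eq, map_star] using Continuous.star ha

/-- The algebra `A_{∞,α} = η_A(ℓ^∞_α(ℕ, A))`. -/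
def contSeqAlg (α : G →* (A ≃⋆ₐ[ℂ] A)) : NonUnitalStarSubalgebra ℂ (SeqAlg A) :=
  (contBddSeq α).map (eta A)

/-- The algebra `F_α(D, A) = κ_{D,A}(A_{∞,α} ∩ D')`. -/
def contKirchbergAlg (α : G →* (A ≃⋆ₐ[ℂ] A)) (D : NonUnitalStarSubalgebra ℂ A) :
    NonUnitalStarSubalgebra ℂ (KirchbergAlg D) :=
  ((contSeqAlg α).comap (NonUnitalStarSubalgebraClass.subtype (commutant D))).map (kappa D)

end Action

/-! ### The Rokhlin property, fixed points, approximate homomorphisms -/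

/-- `u` is the (two-sided) multiplicative identity of `B`. -/
def IsIdentity {B : Type*} [Mul B] (u : B) : Prop := ∀ b : B, u * b = b ∧ b * u = b

/-- A C⋆-algebra is σ-unital if it has a sequential approximate unit of positive contractions. -/
def IsSigmaUnital (A : Type*) [NonUnitalCStarAlgebra A] [PartialOrder A] : Prop :=
  ∃ e : ℕ → A, (Filter.map e atTop).IsIncreasingApproximateUnit

/-- Left translation on `C(G)`: `Lt_g(f)(h) = f(g⁻¹ h)`. -/
def leftTranslate {G : Type*} [Group G] [TopologicalSpace G] [IsTopologicalGroup G]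
    (g : G) (f : C(G, ℂ)) : C(G, ℂ) :=
  f.comp ⟨fun h => g⁻¹ * h, continuous_const_mul g⁻¹⟩

/-- The Rokhlin property: for every separable `α`-invariant C⋆-subalgebra `D` of `A` there is a
unital equivariant ⋆-homomorphism `(C(G), Lt) → (F_α(D, A), F(α))`. -/
def HasRokhlinProperty {G : Type*} [Group G] [TopologicalSpace G] [IsTopologicalGroup G]
    [CompactSpace G] {A : Type*} [NonUnitalCStarAlgebra A] (α : G →* (A ≃⋆ₐ[ℂ] A)) : Prop :=
  ∀ (D : NonUnitalStarSubalgebra ℂ A) (_ : IsClosed (D : Set A))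
    (_ : TopologicalSpace.IsSeparable (D : Set A)) (hD : ∀ g, ∀ d ∈ D, α g d ∈ D),
    ∃ φ : C(G, ℂ) →⋆ₙₐ[ℂ] contKirchbergAlg α D,
      IsIdentity (φ 1) ∧
      ∀ (g : G) (f : C(G, ℂ)),
        (φ (leftTranslate g f) : KirchbergAlg D) =
          actKirchbergAlg α D hD g (φ f : KirchbergAlg D)

section FixedPoints

variable {G : Type*} [Group G] {A : Type*} [NonUnitalCStarAlgebra A]

/-- The fixed point algebra `A^α`. -/
def fixedPoints (α : G →* (A ≃⋆ₐ[ℂ] A)) : NonUnitalStarSubalgebra ℂ A where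
  carrier := {a | ∀ g, α g a = a}
  zero_mem' g := map_zero (α g)
  add_mem' {a b} ha hb g := by rw [map_add, ha g, hb g]
  mul_mem' {a b} ha hb g := by rw [map_mul, ha g, hb g]
  smul_mem' c a ha g := by rw [map_smul, ha g]
  star_mem' {a} ha g := by rw [map_star, ha g]

instance isClosed_fixedPoints (α : G →* (A ≃⋆ₐ[ℂ] A)) :
    IsClosed (fixedPoints α : Set A) := by
  have h : (fixedPoints α : Set A) = ⋂ g, {a | α g a = a} := by
    ext a
    simp only [Set.mem_iInter, Set.mem_ofPred_eq]
    exact Iff.rfl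
  rw [h]
  exact isClosed_iInter fun g =>
    isClosed_eq (NonUnitalStarAlgHom.isometry (α g) (α g).injective).continuous continuous_id

/-- The order inherited from `A` is the C⋆-algebra order of `A^α`: a fixed point which is positive
in `A` is of the form `x⋆x` for some fixed point `x`. -/
instance starOrderedRing_fixedPoints [PartialOrder A] [StarOrderedRing A]
    (α : G →* (A ≃⋆ₐ[ℂ] A)) : StarOrderedRing (fixedPoints α) := by
  refine StarOrderedRing.of_nonneg_iff' ?_ ?_
  · intro x y hxy z
    exact add_le_add_right (show (x : A) ≤ y from hxy) (z : A)
  · intro x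
    constructor
    · intro hx
      have hx' : 0 ≤ (x : A) := hx
      have hs : CFC.sqrt (x : A) ∈ fixedPoints α := by
        intro g
        have h0 : 0 ≤ α g (CFC.sqrt (x : A)) := map_nonneg (α g) (CFC.sqrt_nonneg (x : A))
        have h1 : α g (CFC.sqrt (x : A)) * α g (CFC.sqrt (x : A)) = x := by
          rw [← map_mul, CFC.sqrt_mul_sqrt_self (x : A) hx', x.2 g]
        exact (CFC.sqrt_unique h1 h0).symm
      refine ⟨⟨_, hs⟩, Subtype.ext ?_⟩
      show (x : A) = star (CFC.sqrt (x : A)) * CFC.sqrt (x : A)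
      rw [(IsSelfAdjoint.of_nonneg (CFC.sqrt_nonneg (x : A))).star_eq,
        CFC.sqrt_mul_sqrt_self (x : A) hx']
    · rintro ⟨s, rfl⟩
      exact star_mul_self_nonneg (s : A)

end FixedPoints

/-- An approximate homomorphism: a sequence of (here linear) maps between C⋆-algebras which is
asymptotically multiplicative and asymptotically ⋆-preserving. -/
structure IsApproximateHom {A B : Type*} [NonUnitalCStarAlgebra A] [NonUnitalCStarAlgebra B]
    (ψ : ℕ → A →ₗ[ℂ] B) : Prop where
  mul : ∀ a b, Tendsto (fun n => ‖ψ n (a * b) - ψ n a * ψ n b‖) atTop (𝓝 0)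
  star : ∀ a, Tendsto (fun n => ‖ψ n (star a) - star (ψ n a)‖) atTop (𝓝 0)

end RokhlinAction

end

/-! For `a` in `A` the function `g ↦ α g a` in `C(G, A)` is fixed by the action that combines left
translation on `G` with `α`, and `a` is sent to it by a homomorphism. If `D` is a separable
invariant subalgebra, the Rokhlin map `φ` and the inclusion of `D` have commuting ranges modulo the
annihilator, so `f ⊗ d ↦ φ(f) d` behaves like an equivariant homomorphism from `C(G) ⊗ D` to `A_∞`.
Evaluating it on `g ↦ α g a` gives a multiplicative, invariant element of `A_∞` that equals `a` when
`a` is fixed.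

To obtain honest maps on `A`, choose a quadratic partition of unity `w i` on `G` along which the
orbits of a finite set vary by at most `δ`, and lift `φ(w i) e` to bounded sequences, `e` being an
invariant local unit. The compressions `T(a) = ∑ i, (z i)⋆ α_{γ i}(a) (z i)` by one far term of
these lifts are completely positive, contractive, and almost multiplicative, invariant and identical
on fixed points (`exists_columns`). Averaging over Haar measure makes the range exactly fixed, at a
small cost because `T(a)` is almost invariant. If `A` has an identity, one more small column makes
the map exactly unital (`exists_approximate_retraction_finset`).

No tensor product or norm on `A_∞` is formed: contractivity of the evaluation is replaced by the
inequality `norm_sum_star_mul_mul_le` applied to representing sequences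
(`eventually_norm_lt_of_eta_eq`). Compact sets and the separable case follow by approximation, since
all maps are contractive. -/

namespace RokhlinAction

/-! ### Cauchy–Schwarz estimate for compressions by a column. -/

section ColumnEstimate

variable {A : Type*} [NonUnitalCStarAlgebra A] [PartialOrder A] [StarOrderedRing A]

theorem star_mul_mul_mul_le (z c : A) {r : ℝ} (hc : ‖c‖ ≤ r) :
    star (c * z) * (c * z) ≤ (r ^ 2) • (star z * z) := by
  have h : star z * (star c * c) * z ≤ ‖star c * c‖ • (star z * z) :=
    CStarAlgebra.star_left_conjugate_le_norm_smul (.star_mul_self c)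
  rw [CStarRing.norm_star_mul_self] at h
  have h2 : star (c * z) * (c * z) = star z * (star c * c) * z := by
    simp only [star_mul, mul_assoc]
  rw [h2]
  refine h.trans (smul_le_smul_of_nonneg_right ?_ (star_mul_self_nonneg z))
  nlinarith [norm_nonneg c]

/-- The compression of a bounded diagonal tuple by a column `z` is bounded by the bound of the tuple
times that of `z⋆ z`. -/
theorem norm_sum_star_mul_mul_le {ι : Type*} [Fintype ι] (z c : ι → A) {r M : ℝ} (hr : 0 ≤ r)
    (hM : 0 < M) (hc : ∀ i, ‖c i‖ ≤ r) (hs : ‖∑ i, star (z i) * z i‖ ≤ M) :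
    ‖∑ i, star (z i) * c i * z i‖ ≤ r * M := by
  set s := ∑ i, star (z i) * z i with hsdef
  set t := ∑ i, star (z i) * c i * z i with htdef
  set P := ∑ i, star (c i * z i) * (c i * z i) with hPdef
  have hP : P ≤ (r ^ 2) • s := by
    rw [hPdef, hsdef, Finset.smul_sum]
    exact Finset.sum_le_sum fun i _ => star_mul_mul_mul_le _ _ (hc i)
  have hst : star t * s * t ≤ M • (star t * t) := by
    refine (CStarAlgebra.star_left_conjugate_le_norm_smul
      (.of_nonneg (Finset.sum_nonneg fun i _ => star_mul_self_nonneg (z i)))).trans ?_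
    exact smul_le_smul_of_nonneg_right hs (star_mul_self_nonneg t)
  -- Cauchy–Schwarz in the Hilbert module of columns: with `t = ⟨z, cz⟩`, the square of `M • cz - z
  -- t` expands to `M² P - 2M t⋆t + t⋆ s t`. Using `s ≤ M` this gives `t⋆t ≤ M P ≤ M r² s`.
  have h0 : 0 ≤ ∑ i, star (M • (c i * z i) - z i * t) * (M • (c i * z i) - z i * t) :=
    Finset.sum_nonneg fun i _ => star_mul_self_nonneg _
  have hexp : ∑ i, star (M • (c i * z i) - z i * t) * (M • (c i * z i) - z i * t) =
      M ^ 2 • P - (2 * M) • (star t * t) + star t * s * t := by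
    have hL (x : A) : star t * x = ∑ i, star (c i * z i) * z i * x := by
      rw [htdef, star_sum, Finset.sum_mul]
      refine Finset.sum_congr rfl fun i _ => ?_
      simp only [star_mul, star_star, mul_assoc]
    have hR (x : A) : x * t = ∑ i, x * star (z i) * (c i * z i) := by
      rw [htdef, Finset.mul_sum]
      refine Finset.sum_congr rfl fun i _ => ?_
      simp only [mul_assoc]
    have h1 := hL t
    have h2 := hR (star t)
    have h3 : star t * s * t = ∑ i, star t * star (z i) * (z i * t) := by
      rw [mul_assoc, hsdef, Finset.sum_mul, Finset.mul_sum]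
      refine Finset.sum_congr rfl fun i _ => ?_
      simp only [mul_assoc]
    rw [two_mul, add_smul]
    nth_rw 1 [h1]
    nth_rw 1 [h2]
    rw [h3, hPdef, Finset.smul_sum, Finset.smul_sum, Finset.smul_sum, ← Finset.sum_add_distrib,
      ← Finset.sum_sub_distrib, ← Finset.sum_add_distrib]
    refine Finset.sum_congr rfl fun i _ => ?_
    simp only [star_sub, star_smul, star_trivial, star_mul, sub_mul, mul_sub, smul_mul_assoc,
      mul_smul_comm, smul_smul, pow_two, mul_assoc, smul_sub]
    abel
  have h1 : M • (star t * t) ≤ M • ((M * r ^ 2) • s) := by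
    have h2 : 0 ≤ M ^ 2 • ((r ^ 2) • s) - (2 * M) • (star t * t) + M • (star t * t) := by
      rw [hexp] at h0
      exact h0.trans (add_le_add (sub_le_sub_right (smul_le_smul_of_nonneg_left hP (sq_nonneg M)) _)
        hst)
    have h3 : M ^ 2 • ((r ^ 2) • s) - (2 * M) • (star t * t) + M • (star t * t) =
        M • ((M * r ^ 2) • s) - M • (star t * t) := by
      simp only [smul_smul, two_mul, add_smul, pow_two, mul_assoc]; abel
    rw [h3] at h2
    exact sub_nonneg.1 h2
  have h2 : ‖M • (star t * t)‖ ≤ ‖M • ((M * r ^ 2) • s)‖ :=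
    CStarAlgebra.norm_le_norm_of_nonneg_of_le
      (smul_nonneg hM.le (star_mul_self_nonneg t)) h1
  rw [norm_smul, norm_smul, norm_smul, CStarRing.norm_star_mul_self, Real.norm_of_nonneg hM.le,
    Real.norm_of_nonneg (by positivity)] at h2
  have h3 := le_of_mul_le_mul_left h2 hM
  have h4 : ‖t‖ ^ 2 ≤ (r * M) ^ 2 := by
    calc ‖t‖ ^ 2 = ‖t‖ * ‖t‖ := by ring
      _ ≤ M * r ^ 2 * ‖s‖ := h3
      _ ≤ M * r ^ 2 * M := by gcongr
      _ = (r * M) ^ 2 := by ring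
  exact le_of_sq_le_sq h4 (by positivity)

end ColumnEstimate

/-! ### Positivity of matrices over `A` and over the fixed point algebra. -/

section MatrixPositivity

variable {A : Type*} [NonUnitalCStarAlgebra A] [PartialOrder A] [StarOrderedRing A]
variable {G : Type*} [Group G]

/-- A positive element has a positive square root fixed by every endomorphism fixing the element. -/
theorem exists_sqrt_fixed {N : A} (hN : 0 ≤ N) :
    ∃ S : A, star S * S = N ∧ ∀ Φ : A →⋆ₙₐ[ℂ] A, Φ N = N → Φ S = S := by
  refine ⟨CFC.sqrt N, ?_, fun Φ hΦ => ?_⟩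
  · rw [(IsSelfAdjoint.of_nonneg (CFC.sqrt_nonneg N)).star_eq, CFC.sqrt_mul_sqrt_self N hN]
  · have h0 : 0 ≤ Φ (CFC.sqrt N) := map_nonneg Φ (CFC.sqrt_nonneg N)
    have h1 : Φ (CFC.sqrt N) * Φ (CFC.sqrt N) = N := by
      rw [← map_mul, CFC.sqrt_mul_sqrt_self N hN, hΦ]
    exact (CFC.sqrt_unique h1 h0).symm

/-- Positivity over the fixed point algebra requires a factor `S⋆S` with fixed entries. The positive
square root taken over `A` is unique, hence unchanged by applying `α g` entrywise, so its entries
are fixed. -/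
theorem fixedPoints_cstarMatrix_nonneg (α : G →* (A ≃⋆ₐ[ℂ] A)) {k : ℕ}
    (M : CStarMatrix (Fin k) (Fin k) (fixedPoints α))
    (hM : 0 ≤ M.map (Subtype.val : fixedPoints α → A)) : 0 ≤ M := by
  obtain ⟨R, h1, hR⟩ := exists_sqrt_fixed hM
  have hfix : ∀ i j, R i j ∈ fixedPoints α := by
    intro i j g
    have h := hR (CStarMatrix.mapₙₐ (α g : A →⋆ₙₐ[ℂ] A)) (by
      ext i j
      exact (M i j).2 g)
    exact congrFun (congrFun h i) j
  let S : CStarMatrix (Fin k) (Fin k) (fixedPoints α) :=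
    CStarMatrix.ofMatrix fun i j => ⟨R i j, hfix i j⟩
  have hS : M = star S * S := by
    ext i j
    have h2 := congrFun (congrFun h1 i) j
    rw [CStarMatrix.mul_apply] at h2 ⊢
    rw [CStarMatrix.map_apply] at h2
    rw [← h2]
    simp [S, CStarMatrix.star_eq_conjTranspose]
    rfl
  rw [hS]
  exact star_mul_self_nonneg S

theorem conjugate_cstarMatrix_nonneg (z : A) {k : ℕ} (M : CStarMatrix (Fin k) (Fin k) A)
    (hM : 0 ≤ M) : 0 ≤ M.map fun a => star z * a * z := by
  let Z : CStarMatrix (Fin k) (Fin k) A := CStarMatrix.ofMatrix (Matrix.diagonal fun _ => z)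
  have h : M.map (fun a => star z * a * z) = star Z * M * Z := by
    ext i j
    simp [Z, CStarMatrix.mul_apply, CStarMatrix.star_eq_conjTranspose, Matrix.diagonal_apply,
      apply_ite star, ite_mul, mul_ite]
  rw [h]
  exact star_left_conjugate_nonneg hM Z

end MatrixPositivity

/-! ### Averaging over normalized Haar measure. -/

section HaarAverage

open MeasureTheory

theorem isProbabilityMeasure_haar_top (G : Type*) [Group G] [TopologicalSpace G]
    [IsTopologicalGroup G] [CompactSpace G] [MeasurableSpace G] [BorelSpace G] :
    IsProbabilityMeasure (Measure.haarMeasure (⊤ : TopologicalSpace.PositiveCompacts G)) :=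
  ⟨Measure.haarMeasure_self⟩

theorem integral_nonneg_of_forall_nonneg {X B : Type*} [TopologicalSpace X] [MeasurableSpace X]
    {μ : Measure X} [IsProbabilityMeasure μ]
    [NonUnitalCStarAlgebra B] [PartialOrder B] [StarOrderedRing B] {f : X → B}
    (hf : Integrable f μ) (h : ∀ x, 0 ≤ f x) : 0 ≤ ∫ x, f x ∂μ :=
  (convex_Ici (0 : B)).integral_mem (CStarAlgebra.isClosed_nonneg (A := B))
    (Eventually.of_forall h) hf

theorem norm_apply_action {G A : Type*} [Group G] [NonUnitalCStarAlgebra A]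
    (α : G →* (A ≃⋆ₐ[ℂ] A)) (g : G) (a : A) : ‖α g a‖ = ‖a‖ :=
  NonUnitalStarAlgHom.norm_map (α g) (α g).injective a

variable {G : Type*} [Group G] [TopologicalSpace G] [IsTopologicalGroup G] [CompactSpace G]
  [MeasurableSpace G] [BorelSpace G]
variable {A : Type*} [NonUnitalCStarAlgebra A]

variable (G) in
/-- The normalized Haar measure of a compact group. -/
noncomputable abbrev haarProb : Measure G := Measure.haarMeasure ⊤

instance : IsProbabilityMeasure (haarProb G) := isProbabilityMeasure_haar_top G

theorem integrable_of_continuous {E : Type*} [NormedAddCommGroup E] {f : G → E}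
    (hf : Continuous f) : Integrable f (haarProb G) :=
  hf.integrable_of_hasCompactSupport (HasCompactSupport.of_compactSpace f)

theorem average_mem_fixedPoints {α : G →* (A ≃⋆ₐ[ℂ] A)} (hα : ∀ a, Continuous fun g => α g a)
    (a : A) : ∫ g, α g a ∂haarProb G ∈ fixedPoints α := by
  intro h
  let L : A →L[ℂ] A := ⟨(α h : A →⋆ₙₐ[ℂ] A), (NonUnitalStarAlgHom.isometry (α h)
    (α h).injective).continuous⟩
  have h1 : α h (∫ g, α g a ∂haarProb G) = ∫ g, α h (α g a) ∂haarProb G :=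
    (L.integral_comp_comm (integrable_of_continuous (hα a))).symm
  rw [h1]
  have h2 : ∀ g, α h (α g a) = α (h * g) a := fun g => by rw [map_mul]; rfl
  simp_rw [h2]
  exact integral_mul_left_eq_self (μ := haarProb G) (fun g => α g a) h

/-- The averaging projection onto the fixed point algebra of a compact group action. -/
noncomputable def average (α : G →* (A ≃⋆ₐ[ℂ] A)) (hα : ∀ a, Continuous fun g => α g a) :
    A →ₗ[ℂ] fixedPoints α where
  toFun a := ⟨∫ g, α g a ∂haarProb G, average_mem_fixedPoints hα a⟩
  map_add' a b := Subtype.ext (by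
    simp only [map_add]
    exact integral_add (integrable_of_continuous (hα a)) (integrable_of_continuous (hα b)))
  map_smul' c a := Subtype.ext (by
    simp only [map_smul]
    exact integral_smul c fun g => α g a)

variable {α : G →* (A ≃⋆ₐ[ℂ] A)} (hα : ∀ a, Continuous fun g => α g a)

theorem coe_average (a : A) : (average α hα a : A) = ∫ g, α g a ∂haarProb G := rfl

theorem norm_average_le (a : A) : ‖average α hα a‖ ≤ ‖a‖ := by
  change ‖∫ g, α g a ∂haarProb G‖ ≤ ‖a‖
  simpa using norm_integral_le_of_norm_le_const (μ := haarProb G)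
    (Eventually.of_forall fun g => (norm_apply_action α g a).le)

theorem average_of_mem {a : A} (ha : a ∈ fixedPoints α) : (average α hα a : A) = a := by
  rw [coe_average]
  have : ∀ g, α g a = a := ha
  simp [this]

/-- Approximate invariance in the mean already suffices for closeness to the average; no uniformity
in `g` is needed. -/
theorem norm_average_sub_le (a : A) :
    ‖(average α hα a : A) - a‖ ≤ ∫ g, ‖α g a - a‖ ∂haarProb G := by
  have h : (average α hα a : A) - a = ∫ g, (α g a - a) ∂haarProb G := by
    rw [integral_sub (integrable_of_continuous (hα a)) (integrable_const a), coe_average]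
    simp
  rw [h]
  exact norm_integral_le_integral_norm _

/-- Entry evaluations are continuous and linear, so averaging entrywise is integrating the positive
matrices `M.map (α g)`, and the positive cone is closed and convex. -/
theorem average_cstarMatrix_nonneg [PartialOrder A] [StarOrderedRing A] {k : ℕ}
    (M : CStarMatrix (Fin k) (Fin k) A) (hM : 0 ≤ M) : 0 ≤ M.map (average α hα) := by
  apply fixedPoints_cstarMatrix_nonneg
  let f : G → CStarMatrix (Fin k) (Fin k) A := fun g => M.map (α g)
  have hf : Continuous f := continuous_pi fun i => continuous_pi fun j => hα (M i j)
  have h0 : 0 ≤ ∫ g, f g ∂haarProb G := by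
    refine integral_nonneg_of_forall_nonneg (integrable_of_continuous hf) fun g => ?_
    exact map_nonneg (CStarMatrix.mapₙₐ (α g : A →⋆ₙₐ[ℂ] A)) hM
  have h1 : (M.map (average α hα)).map (Subtype.val : fixedPoints α → A) =
      ∫ g, f g ∂haarProb G := by
    ext i j
    let L : CStarMatrix (Fin k) (Fin k) A →L[ℂ] A :=
      ⟨{ toFun := fun N => N i j, map_add' := fun _ _ => rfl, map_smul' := fun _ _ => rfl },
        (continuous_apply j).comp (continuous_apply i)⟩
    exact L.integral_comp_comm (integrable_of_continuous hf)
  rw [h1]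
  exact h0

/-- A uniformly bounded sequence of functions which is pointwise eventually at
most `r` has integrals eventually below any larger bound. -/
theorem eventually_integral_lt {f : ℕ → G → ℝ} {C r r' : ℝ} (hr : 0 ≤ r) (hr' : r < r')
    (hf : ∀ n, Continuous (f n)) (hC : ∀ n g, f n g ≤ C)
    (h : ∀ g, ∀ᶠ n in atTop, f n g ≤ r) :
    ∀ᶠ n in atTop, ∫ g, f n g ∂haarProb G < r' := by
  -- The functions `f n` need not converge, but their excess over `r` vanishes eventually at each
  -- point and is dominated by `|C|`.
  have hlim : Tendsto (fun n => ∫ g, max (f n g - r) 0 ∂haarProb G) atTop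
      (𝓝 (∫ _, 0 ∂haarProb G)) := by
    refine tendsto_integral_of_dominated_convergence (fun _ => |C|) (fun n => ?_)
      (integrable_const _) (fun n => Eventually.of_forall fun g => ?_)
      (Eventually.of_forall fun g => ?_)
    · exact (integrable_of_continuous (by fun_prop)).aestronglyMeasurable
    · rw [Real.norm_of_nonneg (le_max_right _ _)]
      exact max_le ((by linarith [hC n g] : f n g - r ≤ C).trans (le_abs_self C)) (abs_nonneg C)
    · refine tendsto_const_nhds.congr' ?_
      filter_upwards [h g] with n hn
      rw [max_eq_right (by linarith)]
  rw [integral_zero] at hlim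
  filter_upwards [hlim.eventually (gt_mem_nhds (sub_pos.2 hr'))] with n hn
  have h1 : ∫ g, f n g ∂haarProb G ≤ ∫ g, (max (f n g - r) 0 + r) ∂haarProb G := by
    refine integral_mono (integrable_of_continuous (hf n))
      (integrable_of_continuous (by fun_prop)) fun g => ?_
    show f n g ≤ max (f n g - r) 0 + r
    linarith [le_max_left (f n g - r) 0]
  rw [integral_add (integrable_of_continuous (by fun_prop)) (integrable_const _)] at h1
  simp at h1
  linarith

end HaarAverage

/-! ### Completely positive maps built from compressions and averaging. -/

section CompressedAverage

variable {G : Type*} [Group G] {A : Type*} [NonUnitalCStarAlgebra A]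

/-- The sum of the compressions of translates `a ↦ ∑ i, (z i)⋆ α_{γ i}(a) (z i)`. -/
def compression (α : G →* (A ≃⋆ₐ[ℂ] A)) {ι : Type*} [Fintype ι] (z : ι → A) (γ : ι → G) :
    A →ₗ[ℂ] A where
  toFun a := ∑ i, star (z i) * α (γ i) a * z i
  map_add' a b := by simp only [map_add, mul_add, add_mul, Finset.sum_add_distrib]
  map_smul' c a := by
    simp only [map_smul, mul_smul_comm, smul_mul_assoc, Finset.smul_sum, RingHom.id_apply]

theorem compression_apply (α : G →* (A ≃⋆ₐ[ℂ] A)) {ι : Type*} [Fintype ι] (z : ι → A) (γ : ι → G)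
    (a : A) : compression α z γ a = ∑ i, star (z i) * α (γ i) a * z i := rfl

variable [PartialOrder A] [StarOrderedRing A]

theorem norm_compression_le (α : G →* (A ≃⋆ₐ[ℂ] A)) {ι : Type*} [Fintype ι] (z : ι → A)
    (γ : ι → G) (hz : ‖∑ i, star (z i) * z i‖ ≤ 1) (a : A) : ‖compression α z γ a‖ ≤ ‖a‖ := by
  simpa [compression_apply] using norm_sum_star_mul_mul_le z (fun i => α (γ i) a) (norm_nonneg a) one_pos
    (fun i => NonUnitalStarAlgHom.norm_apply_le (α (γ i)) a) hz

theorem compression_cstarMatrix_nonneg (α : G →* (A ≃⋆ₐ[ℂ] A)) {ι : Type*} [Fintype ι] (z : ι → A)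
    (γ : ι → G) {k : ℕ} (M : CStarMatrix (Fin k) (Fin k) A) (hM : 0 ≤ M) :
    0 ≤ M.map (compression α z γ) := by
  have h : M.map (compression α z γ) =
      ∑ i, (M.map (α (γ i))).map fun a => star (z i) * a * z i := by
    ext j l
    let L : CStarMatrix (Fin k) (Fin k) A →+ A :=
      { toFun := fun N => N j l, map_zero' := rfl, map_add' := fun _ _ => rfl }
    exact (map_sum L (fun i => (M.map (α (γ i))).map fun a => star (z i) * a * z i) _).symm
  rw [h]
  refine Finset.sum_nonneg fun i _ => conjugate_cstarMatrix_nonneg _ _ ?_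
  exact map_nonneg (CStarMatrix.mapₙₐ (α (γ i) : A →⋆ₙₐ[ℂ] A)) hM

variable [TopologicalSpace G] [IsTopologicalGroup G] [CompactSpace G]
  [MeasurableSpace G] [BorelSpace G]

/-- The completely positive map obtained by averaging a sum of compressions of translates. -/
noncomputable def averagedCompression (α : G →* (A ≃⋆ₐ[ℂ] A)) (hα : ∀ a, Continuous fun g => α g a)
    {ι : Type*} [Fintype ι] (z : ι → A) (γ : ι → G) : A →CP fixedPoints α where
  toLinearMap := average α hα ∘ₗ compression α z γ
  map_cstarMatrix_nonneg' _ M hM :=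
    average_cstarMatrix_nonneg hα _ (compression_cstarMatrix_nonneg α z γ M hM)

end CompressedAverage

/-! ### Separable invariant subalgebras. -/

section Separability

open TopologicalSpace

theorem isSeparable_subsemigroupClosure {X : Type*} [TopologicalSpace X] [Semigroup X]
    [ContinuousMul X] {s : Set X} (hs : IsSeparable s) :
    IsSeparable (Subsemigroup.closure s : Set X) := by
  -- `P n` consists of the products of `n + 1` factors from `s`, so products of elements of `P m`
  -- and `P n` lie in `P (m + n + 1)`.
  let P : ℕ → Set X := fun n => Nat.rec s (fun _ t => (fun p : X × X => p.1 * p.2) '' (t ×ˢ s)) n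
  have hP : ∀ n, IsSeparable (P n) := by
    intro n
    induction n with
    | zero => exact hs
    | succ n ih => exact (ih.prod hs).image continuous_mul
  have hmul : ∀ m n x y, x ∈ P m → y ∈ P n → x * y ∈ P (m + n + 1) := by
    intro m n
    induction n with
    | zero => exact fun x y hx hy => ⟨(x, y), ⟨hx, hy⟩, rfl⟩
    | succ n ih =>
      rintro x _ hx ⟨⟨y, t⟩, ⟨hy, ht⟩, rfl⟩
      exact ⟨(x * y, t), ⟨ih x y hx hy, ht⟩, mul_assoc x y t⟩
  refine (IsSeparable.iUnion hP).mono fun x hx => ?_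
  induction hx using Subsemigroup.closure_induction with
  | mem x hx => exact Set.mem_iUnion.2 ⟨0, hx⟩
  | mul x y _ _ hx hy =>
    obtain ⟨m, hm⟩ := Set.mem_iUnion.1 hx
    obtain ⟨n, hn⟩ := Set.mem_iUnion.1 hy
    exact Set.mem_iUnion.2 ⟨m + n + 1, hmul m n x y hm hn⟩

variable {G : Type*} [Group G] [TopologicalSpace G] [CompactSpace G]
variable {A : Type*} [NonUnitalCStarAlgebra A]

/-- Orbits are compact, hence separable, and a generated star subalgebra is the span of the
semigroup generated by the generators and their adjoints. -/
theorem exists_separable_invariant {α : G →* (A ≃⋆ₐ[ℂ] A)} (hα : ∀ a, Continuous fun g => α g a)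
    (F : Finset A) :
    ∃ D : NonUnitalStarSubalgebra ℂ A, IsClosed (D : Set A) ∧ IsSeparable (D : Set A) ∧
      (∀ g, ∀ d ∈ D, α g d ∈ D) ∧ ∀ a ∈ F, a ∈ D := by
  let X : Set A := ⋃ a ∈ F, Set.range fun g => α g a
  have hX : IsCompact X := F.isCompact_biUnion fun a _ => isCompact_range (hα a)
  have hXs : IsSeparable (X ∪ star X) := by
    refine hX.isSeparable.union ?_
    rw [← Set.image_star]
    exact hX.isSeparable.image continuous_star
  let B := NonUnitalStarAlgebra.adjoin ℂ X
  have hXg : ∀ g x, x ∈ X → α g x ∈ X := by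
    intro g x hx
    obtain ⟨a, ha, h, rfl⟩ := Set.mem_iUnion₂.1 hx
    refine Set.mem_iUnion₂.2 ⟨a, ha, g * h, ?_⟩
    show α (g * h) a = α g (α h a)
    rw [map_mul]; rfl
  have hBg : ∀ g, ∀ b ∈ B, α g b ∈ B := by
    intro g b hb
    have h : B ≤ B.comap (α g : A →⋆ₙₐ[ℂ] A) :=
      NonUnitalStarAlgebra.adjoin_le fun x hx =>
        NonUnitalStarAlgebra.subset_adjoin ℂ X (hXg g x hx)
    exact h hb
  refine ⟨B.topologicalClosure, B.isClosed_topologicalClosure, ?_, ?_, ?_⟩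
  · refine (isSeparable_closure (s := (B : Set A))).2 ?_
    have h := congrArg (fun S : Submodule ℂ A => (S : Set A))
      (NonUnitalStarAlgebra.adjoin_eq_span (R := ℂ) X)
    have h2 : (B : Set A) =
        (Submodule.span ℂ (Subsemigroup.closure (X ∪ star X) : Set A) : Set A) := h
    rw [h2]
    exact (isSeparable_subsemigroupClosure hXs).span
  · intro g d hd
    exact map_mem_closure (NonUnitalStarAlgHom.isometry (α g) (α g).injective).continuous hd
      (hBg g)
  · intro a ha
    refine B.le_topologicalClosure (NonUnitalStarAlgebra.subset_adjoin ℂ X ?_)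
    exact Set.mem_iUnion₂.2 ⟨a, ha, 1, by simp⟩

end Separability

/-! ### A fixed approximate unit. -/

section ApproximateUnit

open MeasureTheory

variable {G : Type*} [Group G] [TopologicalSpace G] [IsTopologicalGroup G] [CompactSpace G]
  [MeasurableSpace G] [BorelSpace G]
variable {A : Type*} [NonUnitalCStarAlgebra A] [PartialOrder A] [StarOrderedRing A]

/-- Averaging an approximate unit keeps it one: `α g (f n) * a - a` is the image under `α g` of `f n
* b - b` with `b = α g⁻¹ a`, so it tends to zero for each `g`, and `eventually_integral_lt` passes
this to the integral. -/
theorem exists_invariant_approximateUnit (hA : IsSigmaUnital A) {α : G →* (A ≃⋆ₐ[ℂ] A)}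
    (hα : ∀ a, Continuous fun g => α g a) :
    ∃ e : ℕ → A, (∀ n, e n ∈ fixedPoints α) ∧ (∀ n, ‖e n‖ ≤ 1) ∧ (∀ n, star (e n) = e n) ∧
      (∀ a, Tendsto (fun n => e n * a) atTop (𝓝 a)) ∧
      ∀ a, Tendsto (fun n => a * e n) atTop (𝓝 a) := by
  obtain ⟨e, he⟩ := hA
  obtain ⟨N, hN⟩ := eventually_atTop.1
    ((eventually_map.1 he.eventually_nonneg).and (eventually_map.1 he.eventually_norm))
  -- Positivity and the norm bound hold only eventually along the filter, hence the shift.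
  let f : ℕ → A := fun n => e (n + N)
  have hf0 : ∀ n, 0 ≤ f n := fun n => (hN _ (Nat.le_add_left _ _)).1
  have hf1 : ∀ n, ‖f n‖ ≤ 1 := fun n => (hN _ (Nat.le_add_left _ _)).2
  have hfa : ∀ a, Tendsto (fun n => f n * a) atTop (𝓝 a) := fun a =>
    (tendsto_map'_iff.1 (he.tendsto_mul_right a)).comp (tendsto_add_atTop_nat N)
  let u : ℕ → A := fun n => average α hα (f n)
  have hus : ∀ n, star (u n) = u n := fun n =>
    (IsSelfAdjoint.of_nonneg (integral_nonneg_of_forall_nonneg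
      (integrable_of_continuous (hα (f n))) fun g => map_nonneg (α g) (hf0 n))).star_eq
  have hua : ∀ a, Tendsto (fun n => u n * a) atTop (𝓝 a) := by
    intro a
    rw [Metric.tendsto_nhds]
    intro ε hε
    have h := eventually_integral_lt (G := G) (f := fun n g => ‖α g (f n) * a - a‖)
      (C := 2 * ‖a‖) (half_pos hε).le (half_lt_self hε)
      (fun n => (((hα (f n)).mul continuous_const).sub continuous_const).norm)
      (fun n g => by
        have h1 := norm_mul_le (α g (f n)) a
        rw [norm_apply_action] at h1
        have h2 := mul_le_mul_of_nonneg_right (hf1 n) (norm_nonneg a)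
        linarith [norm_sub_le (α g (f n) * a) a])
      (fun g => by
        filter_upwards [(Metric.tendsto_nhds.1 (hfa (α g⁻¹ a))) (ε / 2) (half_pos hε)] with n hn
        have h1 : α g (f n) * a - a = α g (f n * α g⁻¹ a - α g⁻¹ a) := by
          have h2 : α g (α g⁻¹ a) = a := by
            rw [← StarAlgEquiv.mul_apply, ← map_mul, mul_inv_cancel, map_one]; rfl
          rw [map_sub, map_mul, h2]
        rw [h1, norm_apply_action, ← dist_eq_norm]
        exact hn.le)
    filter_upwards [h] with n hn
    refine lt_of_le_of_lt ?_ hn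
    have h1 : u n * a - a = ∫ g, (α g (f n) * a - a) ∂haarProb G := by
      have hi : Integrable (fun g => α g (f n) * a) (haarProb G) :=
        integrable_of_continuous ((hα (f n)).mul continuous_const)
      rw [integral_sub hi (integrable_const a)]
      congr 1
      · exact ((ContinuousLinearMap.mul ℂ A).flip a).integral_comp_comm
          (integrable_of_continuous (hα (f n))) |>.symm
      · simp
    rw [dist_eq_norm, h1]
    exact norm_integral_le_integral_norm _
  refine ⟨u, fun n => (average α hα (f n)).2, fun n => (norm_average_le hα _).trans (hf1 n), hus,
    hua, fun a => ?_⟩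
  have h := (hua (star a)).star
  simpa [hus] using h

end ApproximateUnit

/-! ### The product of `F(D, A)` with `D`, with values in `A_∞`. -/

section CentralMultiplication

variable {A : Type*} [NonUnitalCStarAlgebra A] {D : NonUnitalStarSubalgebra ℂ A}

/-- A lift of an element of `F(D, A)` to `A_∞ ∩ D'`. -/
noncomputable def kirchbergLift (q : KirchbergAlg D) : commutant D :=
  Function.surjInv (f := kappa D) (annihilator D).proj_surjective q

theorem kappa_kirchbergLift (q : KirchbergAlg D) : kappa D (kirchbergLift q) = q :=
  Function.surjInv_eq (f := kappa D) (annihilator D).proj_surjective q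

/-- The product of an element of `F(D, A)` and an element of `A`, meaningful for elements of `D`. -/
noncomputable def mulIncl (q : KirchbergAlg D) (d : A) : SeqAlg A :=
  (kirchbergLift q : SeqAlg A) * incl A d

/-- Two lifts differ by an element annihilating `D`, so the product with `d ∈ D` does not depend on
the lift. -/
theorem coe_mul_incl (x : commutant D) {d : A} (hd : d ∈ D) :
    (x : SeqAlg A) * incl A d = mulIncl (kappa D x) d := by
  have h : kappa D (x - kirchbergLift (kappa D x)) = 0 := by
    rw [map_sub, kappa_kirchbergLift, sub_self]
  have h1 := ((annihilator D).proj_eq_zero_iff.1 h d hd).1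
  have h2 : ((x : SeqAlg A) - (kirchbergLift (kappa D x) : SeqAlg A)) * incl A d = 0 := h1
  rwa [sub_mul, sub_eq_zero] at h2

theorem mulIncl_add_left (q q' : KirchbergAlg D) {d : A} (hd : d ∈ D) :
    mulIncl (q + q') d = mulIncl q d + mulIncl q' d := by
  obtain ⟨x, rfl⟩ := (annihilator D).proj_surjective q
  obtain ⟨y, rfl⟩ := (annihilator D).proj_surjective q'
  rw [← map_add, ← coe_mul_incl x hd, ← coe_mul_incl y hd, ← coe_mul_incl _ hd]
  exact add_mul _ _ _

theorem mulIncl_zero_left {d : A} (hd : d ∈ D) : mulIncl (0 : KirchbergAlg D) d = 0 := by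
  rw [← map_zero (kappa D), ← coe_mul_incl _ hd]
  exact zero_mul _

theorem mulIncl_sum_left {ι : Type*} (s : Finset ι) (q : ι → KirchbergAlg D) {d : A}
    (hd : d ∈ D) : mulIncl (∑ i ∈ s, q i) d = ∑ i ∈ s, mulIncl (q i) d := by
  let L : KirchbergAlg D →+ SeqAlg A :=
    { toFun := fun q => mulIncl q d, map_zero' := mulIncl_zero_left hd,
      map_add' := fun q q' => mulIncl_add_left q q' hd }
  exact map_sum L q s

theorem mulIncl_sub (q : KirchbergAlg D) (d d' : A) :
    mulIncl q (d - d') = mulIncl q d - mulIncl q d' := by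
  rw [mulIncl, map_sub, mul_sub]; rfl

theorem incl_mul_mulIncl (q : KirchbergAlg D) {d : A} (d' : A) (hd : d ∈ D) :
    incl A d * mulIncl q d' = mulIncl q (d * d') := by
  rw [mulIncl, mulIncl, map_mul, ← mul_assoc, ← mul_assoc,
    (kirchbergLift q).2 d hd]

/-- Lifts commute with `D`. With `star_mulIncl` and `actSeqAlg_mulIncl` this makes `q ⊗ d ↦ mulIncl
q d` behave as an equivariant star homomorphism. -/
theorem mulIncl_mul_mulIncl (q q' : KirchbergAlg D) {d d' : A} (hd : d ∈ D) (hd' : d' ∈ D) :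
    mulIncl q d * mulIncl q' d' = mulIncl (q * q') (d * d') := by
  obtain ⟨x, rfl⟩ := (annihilator D).proj_surjective q
  obtain ⟨y, rfl⟩ := (annihilator D).proj_surjective q'
  rw [← map_mul, ← coe_mul_incl x hd, ← coe_mul_incl _ (mul_mem hd hd'), mul_assoc,
    incl_mul_mulIncl _ _ hd, ← coe_mul_incl y (mul_mem hd hd'), ← mul_assoc]
  rfl

theorem star_mulIncl (q : KirchbergAlg D) {d : A} (hd : d ∈ D) :
    star (mulIncl q d) = mulIncl (star q) (star d) := by
  obtain ⟨x, rfl⟩ := (annihilator D).proj_surjective q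
  rw [← map_star, ← coe_mul_incl x hd, ← coe_mul_incl _ (star_mem hd), star_mul, ← map_star]
  exact ((star x).2 (star d) (star_mem hd)).symm

theorem actSeqAlg_mulIncl {G : Type*} [Group G] (α : G →* (A ≃⋆ₐ[ℂ] A))
    (hD : ∀ g, ∀ d ∈ D, α g d ∈ D) (g : G) (q : KirchbergAlg D) {d : A} (hd : d ∈ D) :
    actSeqAlg α g (mulIncl q d) = mulIncl (actKirchbergAlg α D hD g q) (α g d) := by
  obtain ⟨x, rfl⟩ := (annihilator D).proj_surjective q
  have h : actKirchbergAlg α D hD g ((annihilator D).proj x) =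
      kappa D (actCommutant α D hD g x) := rfl
  rw [h, ← coe_mul_incl x hd, ← coe_mul_incl _ (hD g d hd), map_mul, actSeqAlg_incl]
  rfl

end CentralMultiplication

/-! ### The identity of `F_α(D, A)`. -/

section RokhlinUnit

variable {G : Type*} [Group G] [TopologicalSpace G]
variable {A : Type*} [NonUnitalCStarAlgebra A]

/-- The identity of `F_α(D, A)` acts as the identity on `D`. -/
theorem mulIncl_isIdentity {α : G →* (A ≃⋆ₐ[ℂ] A)} {D : NonUnitalStarSubalgebra ℂ A}
    {e : ℕ → A} (he : ∀ n, e n ∈ fixedPoints α) (he1 : ∀ n, ‖e n‖ ≤ 1)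
    (hel : ∀ a, Tendsto (fun n => e n * a) atTop (𝓝 a))
    (her : ∀ a, Tendsto (fun n => a * e n) atTop (𝓝 a))
    (q : contKirchbergAlg α D) (hq : IsIdentity q) {d : A} (hd : d ∈ D) :
    mulIncl (q : KirchbergAlg D) d = incl A d := by
  let E : BddSeq A := ⟨e, memℓp_top_of_norm_le he1⟩
  have hEl : ∀ a, eta A E * incl A a = incl A a := by
    intro a
    refine ((nullSeq A).cls_eq_iff (a := E * constSeq A a)).2 ?_
    have h := tendsto_iff_norm_sub_tendsto_zero.1 (hel a)
    exact h
  have hEr : ∀ a, incl A a * eta A E = incl A a := by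
    intro a
    refine ((nullSeq A).cls_eq_iff (a := constSeq A a * E)).2 ?_
    have h := tendsto_iff_norm_sub_tendsto_zero.1 (her a)
    exact h
  let x : commutant D := ⟨eta A E, fun d _ => by rw [hEl, hEr]⟩
  have hE : E ∈ contBddSeq α := by
    have h : ∀ g, actBddSeq α g E = E := fun g => by
      ext n
      exact he n g
    show Continuous fun g => actBddSeq α g E
    simp only [h]
    exact continuous_const
  -- The element `q` is an identity only for `F_α(D, A)`, so it is tested on the class of the
  -- approximate unit, which belongs there because its terms are fixed. Since `x` acts as the
  -- identity on `D`, so does every lift of `q`.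
  let p : contKirchbergAlg α D := ⟨kappa D x, x, ⟨E, hE, rfl⟩, rfl⟩
  have h1 : (q : KirchbergAlg D) * kappa D x = kappa D x := congrArg Subtype.val (hq p).1
  obtain ⟨y, hy⟩ := (annihilator D).proj_surjective (q : KirchbergAlg D)
  rw [← hy, ← map_mul] at h1
  have h2 := coe_mul_incl (y * x) hd
  rw [h1, ← coe_mul_incl x hd] at h2
  have h3 : (y : SeqAlg A) * (x : SeqAlg A) * incl A d = (x : SeqAlg A) * incl A d := h2
  have h4 : (x : SeqAlg A) * incl A d = incl A d := hEl d
  rw [mul_assoc, h4] at h3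
  rw [← hy, ← coe_mul_incl y hd, h3]

end RokhlinUnit

/-! ### Partitions of unity adapted to orbits. -/

section OrbitPartition

variable {G : Type*} [Group G] [TopologicalSpace G] [CompactSpace G]
variable {A : Type*} [NonUnitalCStarAlgebra A]

/-- A quadratic partition of unity on `G` subordinate to the variation of finitely many orbits. -/
theorem exists_orbit_partition {α : G →* (A ≃⋆ₐ[ℂ] A)} (hα : ∀ a, Continuous fun g => α g a)
    (F : Finset A) {δ : ℝ} (hδ : 0 < δ) :
    ∃ (t : Finset G) (w : t → C(G, ℂ)), (∑ i, star (w i) * w i = 1) ∧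
      ∀ i g, w i g ≠ 0 → ∀ a ∈ F, ‖α g a - α i a‖ ≤ δ := by
  -- The bump is nonzero only where the total variation over `F` is below `δ`; dividing by the root
  -- of the sum of squares then normalizes the partition.
  let u : G → G → ℝ := fun x g => max 0 (δ - ∑ a ∈ F, ‖α g a - α x a‖)
  have huc : ∀ x, Continuous (u x) := fun x =>
    continuous_const.max (continuous_const.sub (continuous_finsetSum _ fun a _ =>
      ((hα a).sub continuous_const).norm))
  have hu0 : ∀ x g, 0 ≤ u x g := fun x g => le_max_left _ _
  obtain ⟨t, ht⟩ := CompactSpace.elim_nhds_subcover (fun x => {g | 0 < u x g}) (fun x =>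
    (isOpen_lt continuous_const (huc x)).mem_nhds (by simpa [u] using hδ))
  let S : G → ℝ := fun g => ∑ i : t, u i g ^ 2
  have hSc : Continuous S := continuous_finsetSum _ fun i _ => (huc i).pow 2
  have hS : ∀ g, 0 < S g := by
    intro g
    have hg : g ∈ ⋃ x ∈ t, {g | 0 < u x g} := by rw [ht]; trivial
    obtain ⟨x, hx, hxg⟩ := Set.mem_iUnion₂.1 hg
    exact Finset.sum_pos' (fun i _ => sq_nonneg _) ⟨⟨x, hx⟩, Finset.mem_univ _, pow_pos hxg 2⟩
  let w : t → C(G, ℂ) := fun i => ⟨fun g => ((u i g / √(S g) : ℝ) : ℂ),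
    Complex.continuous_ofReal.comp ((huc i).div hSc.sqrt fun g => (Real.sqrt_pos.2 (hS g)).ne')⟩
  refine ⟨t, w, ?_, ?_⟩
  · ext g
    have h1 : ∀ i, (star (w i) * w i) g = ((u i g ^ 2 / S g : ℝ) : ℂ) := by
      intro i
      show (starRingEnd ℂ) ((u i g / √(S g) : ℝ) : ℂ) * ((u i g / √(S g) : ℝ) : ℂ) = _
      rw [Complex.conj_ofReal, ← Complex.ofReal_mul, div_mul_div_comm,
        Real.mul_self_sqrt (hS g).le, pow_two]
    rw [ContinuousMap.sum_apply, Finset.sum_congr rfl fun i _ => h1 i, ← Complex.ofReal_sum,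
      ← Finset.sum_div, div_self (hS g).ne']
    simp
  · intro i g hi a ha
    have h1 : u i g ≠ 0 := by
      intro h
      apply hi
      show ((u i g / √(S g) : ℝ) : ℂ) = 0
      rw [h]; simp
    have h2 : 0 < δ - ∑ a ∈ F, ‖α g a - α i a‖ := by
      by_contra h
      exact h1 (max_eq_left (not_lt.1 h))
    have h3 := Finset.single_le_sum (f := fun a => ‖α g a - α i a‖) (fun a _ => norm_nonneg _) ha
    linarith

end OrbitPartition

/-! ### Columns representing `φ(w i) e` and contractivity of evaluation. -/

section Columns

variable {A : Type*} [NonUnitalCStarAlgebra A]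

theorem tendsto_norm_sub_of_eta_eq {x y : BddSeq A} (h : eta A x = eta A y) :
    Tendsto (fun n => ‖x n - y n‖) atTop (𝓝 0) :=
  ((nullSeq A).cls_eq_iff).1 h

theorem sum_compress_apply {ι : Type*} [Fintype ι] (y : ι → BddSeq A) (c : ι → A) (n : ℕ) :
    (∑ i, star (y i) * constSeq A (c i) * y i : BddSeq A) n =
      ∑ i, star (y i n) * c i * y i n := by
  rw [lp.coeFn_sum, Finset.sum_apply]
  rfl

variable {X : Type*} [TopologicalSpace X] {D : NonUnitalStarSubalgebra ℂ A}

/-- A bounded sequence representing `φ(w) e`. -/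
noncomputable def column (φ : C(X, ℂ) →⋆ₙₐ[ℂ] KirchbergAlg D) (e : A) (w : C(X, ℂ)) : BddSeq A :=
  Function.surjInv (f := eta A) (nullSeq A).proj_surjective (kirchbergLift (φ w) : SeqAlg A) *
    constSeq A e

theorem eta_column (φ : C(X, ℂ) →⋆ₙₐ[ℂ] KirchbergAlg D) (e : A) (w : C(X, ℂ)) :
    eta A (column φ e w) = mulIncl (φ w) e := by
  rw [column, map_mul, Function.surjInv_eq (f := eta A)]
  rfl

theorem eta_star_column_mul (φ : C(X, ℂ) →⋆ₙₐ[ℂ] KirchbergAlg D) {e c : A} (he : e ∈ D)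
    (hc : c ∈ D) (w : C(X, ℂ)) :
    eta A (star (column φ e w) * constSeq A c * column φ e w) =
      mulIncl (φ (star w * w)) (star e * (c * e)) := by
  have h : eta A (constSeq A c) = incl A c := rfl
  rw [map_mul, map_mul, map_star, eta_column, h, mul_assoc, incl_mul_mulIncl _ _ hc,
    star_mulIncl _ he, mulIncl_mul_mulIncl _ _ (star_mem he) (mul_mem hc he), map_mul, map_star]

variable (φ : C(X, ℂ) →⋆ₙₐ[ℂ] KirchbergAlg D) {ι : Type*} [Fintype ι] {w : ι → C(X, ℂ)}

theorem eta_sum_star_column_mul_self (h1 : ∀ d ∈ D, mulIncl (φ 1) d = incl A d)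
    (hw : ∑ i, star (w i) * w i = 1) {e : A} (he : e ∈ D) :
    eta A (∑ i, star (column φ e (w i)) * column φ e (w i)) = incl A (star e * e) := by
  have hd : star e * e ∈ D := mul_mem (star_mem he) he
  rw [map_sum, ← h1 _ hd, ← hw, map_sum, mulIncl_sum_left _ _ hd]
  refine Finset.sum_congr rfl fun i _ => ?_
  rw [map_mul, map_star, eta_column, star_mulIncl _ he,
    mulIncl_mul_mulIncl _ _ (star_mem he) he, map_mul, map_star]

theorem tendsto_sum_star_column_mul_self (h1 : ∀ d ∈ D, mulIncl (φ 1) d = incl A d)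
    (hw : ∑ i, star (w i) * w i = 1) {e : A} (he : e ∈ D) :
    Tendsto (fun n => ‖∑ i, star (column φ e (w i) n) * column φ e (w i) n - star e * e‖) atTop
      (𝓝 0) := by
  have h := tendsto_norm_sub_of_eta_eq (x := ∑ i, star (column φ e (w i)) * column φ e (w i))
    (y := constSeq A (star e * e)) (eta_sum_star_column_mul_self φ h1 hw he)
  refine h.congr fun n => ?_
  rw [lp.coeFn_sum, Finset.sum_apply]
  rfl

theorem mulIncl_expand (hw : ∑ i, star (w i) * w i = 1) (q : C(X, ℂ)) {d : A} (hd : d ∈ D) :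
    mulIncl (φ q) d = ∑ i, mulIncl (φ (q * (star (w i) * w i))) d := by
  conv_lhs => rw [← mul_one q, ← hw, Finset.mul_sum, map_sum]
  exact mulIncl_sum_left _ _ hd

variable [PartialOrder A] [StarOrderedRing A]

/-- The evaluation `∑ w i⋆ w i ⊗ c i ↦ ∑ φ(w i⋆ w i) e⋆ (c i) e` is asymptotically contractive. -/
theorem eventually_norm_lt_of_eta_eq (h1 : ∀ d ∈ D, mulIncl (φ 1) d = incl A d)
    (hw : ∑ i, star (w i) * w i = 1) {e : A}
    (he : e ∈ D) (he1 : ‖e‖ ≤ 1) {c : ι → A} (hc : ∀ i, c i ∈ D) {r r' : ℝ} (hr : 0 ≤ r) (hr' : r < r') (hcr : ∀ i, w i ≠ 0 → ‖c i‖ ≤ r)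
    {x : BddSeq A}
    (hx : eta A x = ∑ i, mulIncl (φ (star (w i) * w i)) (star e * (c i * e))) :
    ∀ᶠ n in atTop, ‖x n‖ < r' := by
  classical
  -- The bound on `c i` is available only when `w i ≠ 0`; the other terms contribute nothing in
  -- `A_∞` and are replaced by zero.
  let c' : ι → A := fun i => if w i = 0 then 0 else c i
  let t : BddSeq A := ∑ i, star (column φ e (w i)) * constSeq A (c' i) * column φ e (w i)
  have ht : eta A t = eta A x := by
    rw [hx, map_sum]
    refine Finset.sum_congr rfl fun i _ => ?_
    by_cases hi : w i = 0
    · rw [eta_star_column_mul φ he (by simp [c', hi, zero_mem]), hi, mul_zero, map_zero,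
        mulIncl_zero_left (mul_mem (star_mem he) (mul_mem (hc i) he)),
        mulIncl_zero_left (mul_mem (star_mem he) (mul_mem (by simp [c', hi, zero_mem]) he))]
    · rw [eta_star_column_mul φ he (by simp [c', hi, hc i])]
      simp [c', hi]
  have hc' : ∀ i, ‖c' i‖ ≤ r := by
    intro i
    by_cases hi : w i = 0
    · simpa [c', hi] using hr
    · simpa [c', hi] using hcr i hi
  have hτ : 0 < (r' - r) / (2 * (r + 1)) := by
    have := sub_pos.2 hr'
    positivity
  -- Half of the gap `r' - r` absorbs the excess of `∑ z⋆ z` over `1`, the other half the distance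
  -- between `x` and `t`. The denominator has `r + 1` because `r` may vanish.
  set τ := (r' - r) / (2 * (r + 1)) with hτdef
  have hrτ : r * (1 + τ) ≤ r + (r' - r) / 2 := by
    have h2 : r * τ ≤ (r' - r) / 2 := by
      have h3 : (r + 1) * τ = (r' - r) / 2 := by rw [hτdef]; field_simp
      nlinarith
    linarith
  have hs := (tendsto_sum_star_column_mul_self φ h1 hw he).eventually (gt_mem_nhds hτ)
  have hd := (tendsto_norm_sub_of_eta_eq ht).eventually
    (gt_mem_nhds (half_pos (sub_pos.2 hr')))
  filter_upwards [hs, hd] with n hn hdn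
  have hee : ‖star e * e‖ ≤ 1 := by
    rw [CStarRing.norm_star_mul_self]
    nlinarith [norm_nonneg e]
  have h4 : ‖∑ i, star (column φ e (w i) n) * column φ e (w i) n‖ ≤ 1 + τ := by
    have h5 := norm_sub_norm_le (∑ i, star (column φ e (w i) n) * column φ e (w i) n) (star e * e)
    linarith
  have h6 : ‖t n‖ ≤ r * (1 + τ) := by
    rw [sum_compress_apply]
    exact norm_sum_star_mul_mul_le _ _ hr (by linarith) hc' h4
  have h7 := norm_sub_norm_le (x n) (t n)
  rw [norm_sub_rev] at h7
  linarith

end Columns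

/-! ### Asymptotic multiplicativity and invariance. -/

section AsymptoticEstimates

theorem star_mul_mul_mul {R : Type*} [CommRing R] [StarRing R] (f g : R) :
    star (f * g) * (f * g) = star f * f * (star g * g) := by
  rw [star_mul]; ring

/-- Sums over two different partitions are compared on their common refinement. -/
theorem sum_star_mul_prod {R ι κ : Type*} [CommRing R] [StarRing R] [Fintype ι]
    [Fintype κ] {w : ι → R} {v : κ → R}
    (hw : ∑ i, star (w i) * w i = 1) (hv : ∑ i, star (v i) * v i = 1) :
    ∑ p : ι × κ, star (w p.1 * v p.2) * (w p.1 * v p.2) = 1 := by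
  calc ∑ p : ι × κ, star (w p.1 * v p.2) * (w p.1 * v p.2)
      = ∑ p : ι × κ, (star (w p.1) * w p.1) * (star (v p.2) * v p.2) := by
        simp only [star_mul_mul_mul]
    _ = 1 := by
        rw [Fintype.sum_prod_type]
        simp only [← Finset.mul_sum, hv, mul_one, hw]

theorem mul_sub_mul_norm_le {A : Type*} [NonUnitalCStarAlgebra A]
    {x y z e : A} {R δ : ℝ} (he1 : ‖e‖ ≤ 1) (hx : ‖x‖ ≤ R)
    (hyz : ‖y - z‖ ≤ 2 * δ) (hz : ‖e * z - z‖ ≤ δ) :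
    ‖x * y - x * (e * (e * z))‖ ≤ R * (4 * δ) := by
  -- The three errors are at most `2δ`, `δ` and `δ`.
  have h1 : x * y - x * (e * (e * z)) = x * ((y - z) - (e * z - z) - e * (e * z - z)) := by
    simp only [mul_sub]; abel
  rw [h1]
  have h2 : ‖e * (e * z - z)‖ ≤ δ := by
    refine (norm_mul_le _ _).trans ?_
    nlinarith [norm_nonneg (e * z - z), norm_nonneg e]
  have h3 := norm_sub_le ((y - z) - (e * z - z)) (e * (e * z - z))
  have h4 := norm_sub_le (y - z) (e * z - z)
  refine (norm_mul_le _ _).trans (mul_le_mul hx ?_ (norm_nonneg _) ((norm_nonneg x).trans hx))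
  linarith


variable {G : Type*} [Group G] [TopologicalSpace G]
variable {A : Type*} [NonUnitalCStarAlgebra A]
variable {α : G →* (A ≃⋆ₐ[ℂ] A)} {D : NonUnitalStarSubalgebra ℂ A}
variable (φ : C(G, ℂ) →⋆ₙₐ[ℂ] KirchbergAlg D)
variable {ι : Type*} [Fintype ι] {w : ι → C(G, ℂ)} {γ : ι → G} {e : A}

variable (α w γ e) in
/-- The sequence of compressions of translates of `a` by the columns representing `φ(w i) e`. -/
noncomputable def translateSeq (a : A) : BddSeq A :=
  ∑ i, star (column φ e (w i)) * constSeq A (α (γ i) a) * column φ e (w i)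

theorem translateSeq_apply (a : A) (n : ℕ) :
    translateSeq α φ w γ e a n = compression α (fun i => column φ e (w i) n) γ a :=
  sum_compress_apply _ _ n

theorem eta_translateSeq (hD : ∀ g, ∀ d ∈ D, α g d ∈ D) (he : e ∈ D) (hes : star e = e) {a : A}
    (ha : a ∈ D) :
    eta A (translateSeq α φ w γ e a) =
      ∑ i, mulIncl (φ (star (w i) * w i)) (e * (α (γ i) a * e)) := by
  rw [translateSeq, map_sum]
  refine Finset.sum_congr rfl fun i _ => ?_
  rw [eta_star_column_mul φ he (hD _ _ ha), hes]

theorem leftTranslate_star_mul [IsTopologicalGroup G] (h : G) (f : C(G, ℂ)) :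
    leftTranslate h (star f * f) = star (leftTranslate h f) * leftTranslate h f := rfl

/-- All coefficients equal `a`, so the partition sums to `φ 1`. -/
theorem translateSeq_fixed_tendsto (h1 : ∀ d ∈ D, mulIncl (φ 1) d = incl A d)
    (hD : ∀ g, ∀ d ∈ D, α g d ∈ D) (hw : ∑ i, star (w i) * w i = 1) (he : e ∈ D)
    (hes : star e = e) {a : A} (ha : a ∈ D) (haf : a ∈ fixedPoints α) :
    Tendsto (fun n => ‖translateSeq α φ w γ e a n - e * (a * e)‖) atTop (𝓝 0) := by
  refine tendsto_norm_sub_of_eta_eq (y := constSeq A (e * (a * e))) ?_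
  have hd : e * (a * e) ∈ D := mul_mem he (mul_mem ha he)
  have h2 : eta A (constSeq A (e * (a * e))) = mulIncl (φ 1) (e * (a * e)) := (h1 _ hd).symm
  have h3 : ∀ g, α g a = a := haf
  rw [eta_translateSeq φ hD he hes ha, h2, ← hw, map_sum, mulIncl_sum_left _ _ hd]
  simp only [h3]

variable [PartialOrder A] [StarOrderedRing A]

/-- Over the product partition the defect has coefficients `α_i(a) (α_i(b) - e e α_k(b))`. If `w i *
w k ≠ 0`, the supports meet at some `g`, and both translates of `b` are within `δ` of `α g b`. -/
theorem eventually_translateSeq_mul (h1 : ∀ d ∈ D, mulIncl (φ 1) d = incl A d)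
    (hD : ∀ g, ∀ d ∈ D, α g d ∈ D) (hw : ∑ i, star (w i) * w i = 1) (he : e ∈ D)
    (hes : star e = e) (hef : e ∈ fixedPoints α) (he1 : ‖e‖ ≤ 1) {a b : A} (ha : a ∈ D)
    (hb : b ∈ D) {R δ ε : ℝ} (hδ : 0 ≤ δ) (haR : ‖a‖ ≤ R) (heb : ‖e * b - b‖ ≤ δ)
    (hγ : ∀ i g, w i g ≠ 0 → ‖α g b - α (γ i) b‖ ≤ δ) (hε : R * (4 * δ) < ε) :
    ∀ᶠ n in atTop, ‖translateSeq α φ w γ e (a * b) n -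
      translateSeq α φ w γ e a n * translateSeq α φ w γ e b n‖ < ε := by
  have hR : 0 ≤ R := (norm_nonneg a).trans haR
  refine eventually_norm_lt_of_eta_eq φ h1 (sum_star_mul_prod hw hw) he he1
    (c := fun p => α (γ p.1) a * α (γ p.1) b - α (γ p.1) a * (e * (e * α (γ p.2) b)))
    (r := R * (4 * δ))
    (x := translateSeq α φ w γ e (a * b) - translateSeq α φ w γ e a * translateSeq α φ w γ e b)
    (fun p => sub_mem (mul_mem (hD _ _ ha) (hD _ _ hb))
      (mul_mem (hD _ _ ha) (mul_mem he (mul_mem he (hD _ _ hb)))))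
    (by positivity) hε (fun p hp => ?_) ?_
  · obtain ⟨g, hg⟩ := DFunLike.ne_iff.1 hp
    have hg1 : w p.1 g ≠ 0 := fun h => hg (by simp [h])
    have hg2 : w p.2 g ≠ 0 := fun h => hg (by simp [h])
    refine mul_sub_mul_norm_le he1 ((norm_apply_action α _ a).le.trans haR) ?_ ?_
    · have h2 := norm_sub_le (α g b - α (γ p.2) b) (α g b - α (γ p.1) b)
      rw [sub_sub_sub_cancel_left] at h2
      linarith [hγ _ _ hg1, hγ _ _ hg2]
    · have h2 : e * α (γ p.2) b - α (γ p.2) b = α (γ p.2) (e * b - b) := by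
        rw [map_sub, map_mul, hef]
      rw [h2, norm_apply_action]
      exact heb
  · rw [map_sub, map_mul, eta_translateSeq φ hD he hes (mul_mem ha hb),
      eta_translateSeq φ hD he hes ha, eta_translateSeq φ hD he hes hb, Finset.sum_mul_sum,
      Fintype.sum_prod_type, ← Finset.sum_sub_distrib]
    refine Finset.sum_congr rfl fun i _ => ?_
    -- The single sum for `a * b` is refined by inserting `∑ k, (w k)⋆ (w k) = 1`.
    rw [mulIncl_expand φ hw _ (mul_mem he (mul_mem (hD _ _ (mul_mem ha hb)) he)),
      ← Finset.sum_sub_distrib]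
    refine Finset.sum_congr rfl fun k _ => ?_
    rw [mulIncl_mul_mulIncl _ _ (mul_mem he (mul_mem (hD _ _ ha) he))
      (mul_mem he (mul_mem (hD _ _ hb) he)), ← map_mul, star_mul_mul_mul, ← mulIncl_sub, hes]
    congr 1
    simp only [mul_sub, sub_mul, mul_assoc, map_mul]

/-- Equivariance turns `α h` of the sum into the sum for the translated partition with coefficients
`α_h α_i(a)`. Where a translated `w i` and `w k` are both nonzero at `g`, this coefficient and
`α_k(a)` are within `δ` of `α g a`. The eventual index depends on `h`. -/
theorem eventually_translateSeq_invariant [IsTopologicalGroup G]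
    (h1 : ∀ d ∈ D, mulIncl (φ 1) d = incl A d)
    (hD : ∀ g, ∀ d ∈ D, α g d ∈ D)
    (hφ : ∀ g f, φ (leftTranslate g f) = actKirchbergAlg α D hD g (φ f))
    (hw : ∑ i, star (w i) * w i = 1) (he : e ∈ D)
    (hes : star e = e) (hef : e ∈ fixedPoints α) (he1 : ‖e‖ ≤ 1) {a : A} (ha : a ∈ D)
    {δ ε : ℝ} (hδ : 0 ≤ δ)
    (hγ : ∀ i g, w i g ≠ 0 → ‖α g a - α (γ i) a‖ ≤ δ) (hε : 2 * δ < ε) (h : G) :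
    ∀ᶠ n in atTop,
      ‖α h (translateSeq α φ w γ e a n) - translateSeq α φ w γ e a n‖ < ε := by
  have hv : ∑ i, star (leftTranslate h (w i)) * leftTranslate h (w i) = 1 := by
    simp only [← leftTranslate_star_mul]
    have h2 := congrArg (leftTranslate h) hw
    ext g
    have h3 := DFunLike.congr_fun h2 g
    simp only [leftTranslate, ContinuousMap.comp_apply, ContinuousMap.sum_apply] at h3 ⊢
    exact h3
  refine eventually_norm_lt_of_eta_eq φ h1 (sum_star_mul_prod hv hw) he he1
    (c := fun p => α h (α (γ p.1) a) - α (γ p.2) a) (r := 2 * δ)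
    (x := actBddSeq α h (translateSeq α φ w γ e a) - translateSeq α φ w γ e a)
    (fun p => sub_mem (hD _ _ (hD _ _ ha)) (hD _ _ ha))
    (by positivity) hε (fun p hp => ?_) ?_
  · obtain ⟨g, hg⟩ := DFunLike.ne_iff.1 hp
    have hg1 : w p.1 (h⁻¹ * g) ≠ 0 := fun h => hg (by simp [leftTranslate, h])
    have hg2 : w p.2 g ≠ 0 := fun h => hg (by simp [h])
    have h2 : α h (α (γ p.1) a) - α (γ p.2) a =
        (α g a - α (γ p.2) a) - α h (α (h⁻¹ * g) a - α (γ p.1) a) := by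
      have h3 : α h (α (h⁻¹ * g) a) = α g a := by
        rw [← StarAlgEquiv.mul_apply, ← map_mul, mul_inv_cancel_left]
      rw [map_sub, h3]; abel
    rw [h2]
    refine (norm_sub_le _ _).trans ?_
    rw [norm_apply_action]
    linarith [hγ _ _ hg1, hγ _ _ hg2]
  · have h2 : eta A (actBddSeq α h (translateSeq α φ w γ e a)) =
        actSeqAlg α h (eta A (translateSeq α φ w γ e a)) := rfl
    rw [map_sub, h2, eta_translateSeq φ hD he hes ha]
    have h3 : ∀ i, actSeqAlg α h (mulIncl (φ (star (w i) * w i)) (e * (α (γ i) a * e))) =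
        ∑ k, mulIncl (φ (star (leftTranslate h (w i)) * leftTranslate h (w i) *
          (star (w k) * w k))) (e * (α h (α (γ i) a) * e)) := by
      intro i
      rw [actSeqAlg_mulIncl α hD h _ (mul_mem he (mul_mem (hD _ _ ha) he)), ← hφ,
        leftTranslate_star_mul, map_mul (α h), map_mul (α h), hef h,
        mulIncl_expand φ hw _ (mul_mem he (mul_mem (hD _ _ (hD _ _ ha)) he))]
    have h4 : ∀ k, mulIncl (φ (star (w k) * w k)) (e * (α (γ k) a * e)) =
        ∑ i, mulIncl (φ (star (leftTranslate h (w i)) * leftTranslate h (w i) *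
          (star (w k) * w k))) (e * (α (γ k) a * e)) := by
      intro k
      rw [mulIncl_expand φ hv _ (mul_mem he (mul_mem (hD _ _ ha) he))]
      simp only [mul_comm (star (w k) * w k)]
    rw [map_sum, Finset.sum_congr rfl fun i _ => h3 i, Finset.sum_congr rfl fun k _ => h4 k,
      Finset.sum_comm (s := Finset.univ) (t := Finset.univ) (f := fun k i =>
      mulIncl (φ (star (leftTranslate h (w i)) * leftTranslate h (w i) *
          (star (w k) * w k))) (e * (α (γ k) a * e))), Fintype.sum_prod_type,
      ← Finset.sum_sub_distrib]
    refine Finset.sum_congr rfl fun i _ => ?_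
    rw [← Finset.sum_sub_distrib]
    refine Finset.sum_congr rfl fun k _ => ?_
    rw [star_mul_mul_mul, ← mulIncl_sub, hes, sub_mul, mul_sub]

end AsymptoticEstimates

/-! ### Identity elements and local units. -/

section IdentityElement

variable {A : Type*} [NonUnitalCStarAlgebra A] {u : A}

theorem IsIdentity.star_eq (hu : IsIdentity u) : star u = u := by
  have h1 := congrArg star (hu (star u)).1
  rw [star_mul, star_star, (hu (star u)).1] at h1
  exact h1

theorem IsIdentity.norm_le_one (hu : IsIdentity u) : ‖u‖ ≤ 1 := by
  have h := CStarRing.norm_star_mul_self (x := u)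
  rw [hu.star_eq, (hu u).1] at h
  nlinarith [norm_nonneg u]

theorem IsIdentity.eq {v : A} (hu : IsIdentity u) (hv : IsIdentity v) : u = v := by
  rw [← (hv u).1, (hu v).2]

theorem IsIdentity.mem_fixedPoints {G : Type*} [Group G] (hu : IsIdentity u)
    (α : G →* (A ≃⋆ₐ[ℂ] A)) : u ∈ fixedPoints α := by
  intro g
  refine IsIdentity.eq (fun b => ?_) hu
  obtain ⟨c, rfl⟩ : ∃ c, α g c = b := (α g).surjective b
  rw [← map_mul, ← map_mul, (hu c).1, (hu c).2]
  exact ⟨rfl, rfl⟩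

variable [PartialOrder A] [StarOrderedRing A]

theorem IsIdentity.le_of_norm_le_one (hu : IsIdentity u) {s : A} (hs : 0 ≤ s) (hs1 : ‖s‖ ≤ 1) :
    s ≤ u := by
  have h : star u * s * u ≤ ‖s‖ • (star u * u) :=
    CStarAlgebra.star_left_conjugate_le_norm_smul (.of_nonneg hs)
  have h0 : 0 ≤ u := by
    have := star_mul_self_nonneg u
    rwa [hu.star_eq, (hu u).1] at this
  rw [hu.star_eq, (hu s).1, (hu s).2, (hu u).1] at h
  refine h.trans ?_
  simpa using smul_le_smul_of_nonneg_right hs1 h0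

end IdentityElement

/-- The factors `n / (n + 1)` make the norm strictly less than `1`. This leaves room for `∑ z⋆ z`,
which only approximates `e⋆ e`, to have norm at most `1` exactly. -/
theorem exists_invariant_local_unit {G A : Type*} [Group G] [NonUnitalCStarAlgebra A]
    {α : G →* (A ≃⋆ₐ[ℂ] A)} {e : ℕ → A}
    (he : ∀ n, e n ∈ fixedPoints α) (he1 : ∀ n, ‖e n‖ ≤ 1) (hes : ∀ n, star (e n) = e n)
    (hel : ∀ a, Tendsto (fun n => e n * a) atTop (𝓝 a))
    (her : ∀ a, Tendsto (fun n => a * e n) atTop (𝓝 a)) (F : Finset A) {δ : ℝ} (hδ : 0 < δ) :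
    ∃ e : A, e ∈ fixedPoints α ∧ star e = e ∧ ‖e‖ < 1 ∧
      ∀ a ∈ F, ‖e * a - a‖ ≤ δ ∧ ‖a * e - a‖ ≤ δ := by
  let c : ℕ → ℝ := fun n => n / (n + 1)
  have hc : Tendsto c atTop (𝓝 1) := tendsto_natCast_div_add_atTop (1 : ℝ)
  have hl : ∀ a, Tendsto (fun n => c n • e n * a) atTop (𝓝 a) := by
    intro a
    have h := hc.smul (hel a)
    simpa only [one_smul, smul_mul_assoc] using h
  have hr : ∀ a, Tendsto (fun n => a * c n • e n) atTop (𝓝 a) := by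
    intro a
    have h := hc.smul (her a)
    simpa only [one_smul, mul_smul_comm] using h
  have hev : ∀ᶠ n in atTop, ∀ a ∈ F, ‖c n • e n * a - a‖ < δ ∧ ‖a * c n • e n - a‖ < δ := by
    refine (Finset.eventually_all F).2 fun a _ => ?_
    filter_upwards [Metric.tendsto_nhds.1 (hl a) δ hδ, Metric.tendsto_nhds.1 (hr a) δ hδ]
      with n h1 h2
    rw [dist_eq_norm] at h1 h2
    exact ⟨h1, h2⟩
  obtain ⟨n, hn⟩ := hev.exists
  have hc0 : 0 ≤ c n := by positivity
  have hc1 : c n < 1 := by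
    rw [div_lt_one (by positivity)]
    linarith
  refine ⟨c n • e n, fun g => ?_, ?_, ?_, fun a ha => ⟨(hn a ha).1.le, (hn a ha).2.le⟩⟩
  · rw [show c n • e n = ((c n : ℝ) : ℂ) • e n from (Complex.coe_smul _ _).symm, map_smul, he n g]
  · rw [star_smul, star_trivial, hes]
  · rw [norm_smul, Real.norm_of_nonneg hc0]
    nlinarith [he1 n, norm_nonneg (e n)]

/-! ### Approximate retractions for finite sets. -/

section Retractions

open MeasureTheory

variable {G : Type*} [Group G] [TopologicalSpace G] [IsTopologicalGroup G] [CompactSpace G]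
  [MeasurableSpace G] [BorelSpace G]
variable {A : Type*} [NonUnitalCStarAlgebra A] [PartialOrder A] [StarOrderedRing A]

/-- Only finitely many asymptotic estimates are involved, so a single index of the representing
sequences satisfies all of them, and the columns are the terms at that index. -/
theorem exists_columns (hA : IsSigmaUnital A) {α : G →* (A ≃⋆ₐ[ℂ] A)}
    (hα : ∀ a : A, Continuous fun g => α g a) (hR : HasRokhlinProperty α) (F : Finset A)
    {R δ : ℝ} (hδ : 0 < δ) (hR1 : 1 ≤ R) (hF : ∀ a ∈ F, ‖a‖ ≤ R) :
    ∃ (t : Finset G) (z : t → A), ‖∑ i, star (z i) * z i‖ ≤ 1 ∧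
      (∀ u ∈ F, IsIdentity u → ‖u - ∑ i, star (z i) * z i‖ ≤ 3 * δ) ∧
      (∀ a ∈ F, ∀ b ∈ F, ‖compression α z (fun i => (i : G)) (a * b) -
        compression α z (fun i => (i : G)) a * compression α z (fun i => (i : G)) b‖ ≤
          5 * R * δ) ∧
      (∀ a ∈ F, ‖(average α hα (compression α z (fun i => (i : G)) a) : A) -
        compression α z (fun i => (i : G)) a‖ ≤ 4 * δ) ∧
      ∀ a ∈ F, a ∈ fixedPoints α → ‖compression α z (fun i => (i : G)) a - a‖ ≤ 3 * δ := by
  classical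
  obtain ⟨ε, hεf, hε1, hεs, hεl, hεr⟩ := exists_invariant_approximateUnit hA hα
  obtain ⟨e, hef, hes, he1, heF⟩ :=
    exists_invariant_local_unit hεf hε1 hεs hεl hεr F hδ
  obtain ⟨D, hDc, hDs, hD, hFD⟩ := exists_separable_invariant hα (insert e F)
  have he : e ∈ D := hFD e (Finset.mem_insert_self e F)
  have hFD' : ∀ a ∈ F, a ∈ D := fun a ha => hFD a (Finset.mem_insert_of_mem ha)
  obtain ⟨φ₀, hφ₀, hφe⟩ := hR D hDc hDs hD
  let φ : C(G, ℂ) →⋆ₙₐ[ℂ] KirchbergAlg D :=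
    (NonUnitalStarSubalgebraClass.subtype (contKirchbergAlg α D)).comp φ₀
  have h1 : ∀ d ∈ D, mulIncl (φ 1) d = incl A d := fun d hd =>
    mulIncl_isIdentity hεf hε1 hεl hεr (φ₀ 1) hφ₀ hd
  obtain ⟨t, w, hw, hγ⟩ := exists_orbit_partition hα F hδ
  let T : A → BddSeq A := translateSeq α φ w (fun i => (i : G)) e
  have hT : ∀ a n, T a n = compression α (fun i => column φ e (w i) n) (fun i => (i : G)) a :=
    translateSeq_apply φ
  have hee : ‖star e * e‖ < 1 := by
    rw [CStarRing.norm_star_mul_self]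
    nlinarith [norm_nonneg e]
  have hs := tendsto_sum_star_column_mul_self φ h1 hw he
  have hs1 := hs.eventually (gt_mem_nhds (sub_pos.2 hee))
  have hs2 := hs.eventually (gt_mem_nhds hδ)
  have hmul : ∀ᶠ n in atTop, ∀ a ∈ F, ∀ b ∈ F, ‖T (a * b) n - T a n * T b n‖ < 5 * R * δ := by
    refine (Finset.eventually_all F).2 fun a ha => (Finset.eventually_all F).2 fun b hb => ?_
    exact eventually_translateSeq_mul φ h1 hD hw he hes hef he1.le (hFD' a ha) (hFD' b hb) hδ.le
      (hF a ha) (heF b hb).1 (fun i g hi => hγ i g hi b hb) (by nlinarith)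
  have hinv : ∀ᶠ n in atTop, ∀ a ∈ F, ∫ g, ‖α g (T a n) - T a n‖ ∂haarProb G < 4 * δ := by
    refine (Finset.eventually_all F).2 fun a ha => ?_
    -- Each strict inequality costs one `δ`: the coefficients are bounded by `2δ`, the pointwise
    -- defect by `3δ`, its integral by `4δ`.
    refine eventually_integral_lt (C := 2 * ‖T a‖) (r := 3 * δ) (by positivity) (by linarith)
      (fun n => ((hα _).sub continuous_const).norm) (fun n g => ?_) fun g => ?_
    · have h2 := norm_sub_le (α g (T a n)) (T a n)
      rw [norm_apply_action] at h2
      linarith [lp.norm_apply_le_norm ENNReal.top_ne_zero (T a) n]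
    · filter_upwards [eventually_translateSeq_invariant φ h1 hD hφe hw he hes hef he1.le
        (hFD' a ha) hδ.le (fun i g hi => hγ i g hi a ha) (by linarith : 2 * δ < 3 * δ) g] with n hn
      exact hn.le
  have hfix : ∀ᶠ n in atTop, ∀ a ∈ F, a ∈ fixedPoints α → ‖T a n - e * (a * e)‖ < δ := by
    refine (Finset.eventually_all F).2 fun a ha => ?_
    by_cases haf : a ∈ fixedPoints α
    · filter_upwards [(translateSeq_fixed_tendsto φ (w := w) (γ := fun i => (i : G)) h1 hD hw he hes
        (hFD' a ha) haf).eventually (gt_mem_nhds hδ)] with n hn _ using hn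
    · exact Eventually.of_forall fun n h => absurd h haf
  obtain ⟨n, hs1, hs2, hmul, hinv, hfix⟩ := (hs1.and (hs2.and (hmul.and (hinv.and hfix)))).exists
  have hconj : ∀ x : A, ‖e * x‖ ≤ ‖x‖ := fun x => (norm_mul_le _ _).trans (by
    nlinarith [norm_nonneg x])
  refine ⟨t, fun i => column φ e (w i) n, ?_, ?_, ?_, ?_, ?_⟩
  · have h2 := norm_sub_norm_le (∑ i, star (column φ e (w i) n) * column φ e (w i) n) (star e * e)
    linarith
  · intro u hu hui
    have h2 : u - ∑ i, star (column φ e (w i) n) * column φ e (w i) n =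
        -(∑ i, star (column φ e (w i) n) * column φ e (w i) n - star e * e) - (e * u - u) -
          e * (e * u - u) := by
      rw [hes, (hui e).2, mul_sub, (hui e).2]; abel
    rw [h2]
    have h3 := norm_sub_le (-(∑ i, star (column φ e (w i) n) * column φ e (w i) n - star e * e) -
      (e * u - u)) (e * (e * u - u))
    have h4 := norm_sub_le (-(∑ i, star (column φ e (w i) n) * column φ e (w i) n - star e * e))
      (e * u - u)
    rw [norm_neg] at h4
    linarith [hconj (e * u - u), (heF u hu).1]
  · intro a ha b hb
    rw [← hT, ← hT, ← hT]
    exact (hmul a ha b hb).le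
  · intro a ha
    rw [← hT]
    exact (norm_average_sub_le hα _).trans (hinv a ha).le
  · intro a ha haf
    rw [← hT]
    have h2 : T a n - a = (T a n - e * (a * e)) + (e * (a * e - a) + (e * a - a)) := by
      rw [mul_sub]; abel
    rw [h2]
    have h3 := norm_add_le (T a n - e * (a * e)) (e * (a * e - a) + (e * a - a))
    have h4 := norm_add_le (e * (a * e - a)) (e * a - a)
    linarith [hconj (a * e - a), (heF a ha).1, (heF a ha).2, hfix a ha haf]

/-- A column of small norm completing `∑ z⋆ z` to the identity, if there is one. -/
theorem exists_completing_column {s : A} (hs0 : 0 ≤ s) (hs : ‖s‖ ≤ 1) {η : ℝ} (hη : 0 ≤ η)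
    (hu : ∀ u : A, IsIdentity u → ‖u - s‖ ≤ η) :
    ∃ v : A, ‖v‖ * ‖v‖ ≤ η ∧ ‖star v * v + s‖ ≤ 1 ∧
      ∀ u : A, IsIdentity u → star v * v + s = u := by
  by_cases h : ∃ u : A, IsIdentity u
  · obtain ⟨u, hui⟩ := h
    obtain ⟨v, hv, -⟩ := exists_sqrt_fixed (sub_nonneg.2 (hui.le_of_norm_le_one hs0 hs))
    refine ⟨v, ?_, ?_, fun u' hu' => ?_⟩
    · rw [← CStarRing.norm_star_mul_self, hv]
      exact hu u hui
    · rw [hv, sub_add_cancel]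
      exact hui.norm_le_one
    · rw [hv, sub_add_cancel]
      exact hui.eq hu'
  -- Without an identity there is nothing to complete, and the zero column serves.
  · exact ⟨0, by simpa using hη, by simpa using hs, fun u hui => absurd ⟨u, hui⟩ h⟩

theorem exists_approximate_retraction_finset (hA : IsSigmaUnital A) {α : G →* (A ≃⋆ₐ[ℂ] A)}
    (hα : ∀ a : A, Continuous fun g => α g a) (hR : HasRokhlinProperty α) (F : Finset A)
    {ε : ℝ} (hε : 0 < ε) :
    ∃ ψ : A →CP fixedPoints α, (∀ a, ‖ψ a‖ ≤ ‖a‖) ∧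
      (∀ a ∈ F, ∀ b ∈ F, ‖ψ (a * b) - ψ a * ψ b‖ < ε) ∧
      (∀ a ∈ F, a ∈ fixedPoints α → ‖(ψ a : A) - a‖ < ε) ∧
      ∀ u : A, IsIdentity u → (ψ u : A) = u := by
  classical
  obtain ⟨U, hU⟩ : ∃ U : Finset A, ∀ u : A, IsIdentity u → u ∈ U := by
    by_cases h : ∃ u : A, IsIdentity u
    · obtain ⟨u, hu⟩ := h
      exact ⟨{u}, fun v hv => by rw [Finset.mem_singleton]; exact hv.eq hu⟩
    · exact ⟨∅, fun u hu => absurd ⟨u, hu⟩ h⟩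
  -- Products are included because `ψ` and `T` are also compared at `a * b`; `U` contains the
  -- identity, if there is one.
  let F' : Finset A := F ∪ Finset.image₂ (· * ·) F F ∪ U
  have hFF' : ∀ a ∈ F, a ∈ F' := fun a ha =>
    Finset.mem_union_left _ (Finset.mem_union_left _ ha)
  have hmF' : ∀ a ∈ F, ∀ b ∈ F, a * b ∈ F' := fun a ha b hb =>
    Finset.mem_union_left _ (Finset.mem_union_right _ (Finset.mem_image₂_of_mem ha hb))
  obtain ⟨R, hR1, hRF⟩ : ∃ R : ℝ, 1 ≤ R ∧ ∀ a ∈ F', ‖a‖ ≤ R :=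
    ⟨1 + ∑ a ∈ F', ‖a‖, by linarith [Finset.sum_nonneg fun a (_ : a ∈ F') => norm_nonneg a],
      fun a ha => by linarith [Finset.single_le_sum (fun a _ => norm_nonneg a) ha]⟩
  -- The multiplicativity defect is at most `7Rδ + 5Rδ + 7R²δ + 7R²δ`, and `R ≥ 1`.
  obtain ⟨δ, hδ, hδε⟩ : ∃ δ : ℝ, 0 < δ ∧ 26 * R ^ 2 * δ < ε := by
    refine ⟨ε / (27 * R ^ 2), by positivity, ?_⟩
    have : 27 * R ^ 2 * (ε / (27 * R ^ 2)) = ε := by field_simp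
    nlinarith
  obtain ⟨t, z, hz1, hzu, hmul, hinv, hfix⟩ := exists_columns hA hα hR F' hδ hR1 hRF
  obtain ⟨v, hv, hv1, hvu⟩ := exists_completing_column
    (Finset.sum_nonneg fun i _ => star_mul_self_nonneg (z i)) hz1 (by positivity : 0 ≤ 3 * δ)
    fun u hu => hzu u (Finset.mem_union_right _ (hU u hu)) hu
  let T := compression α z fun i => (i : G)
  -- With `v` as an extra column at the group element `1`, the map is still an averaged compression,
  -- so complete positivity and contractivity need no new argument.
  let z' : Option t → A := fun o => o.elim v z
  let γ' : Option t → G := fun o => o.elim 1 fun i => (i : G)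
  have hsum : ∑ o, star (z' o) * z' o = star v * v + ∑ i, star (z i) * z i :=
    Fintype.sum_option _
  have hT' : ∀ a, compression α z' γ' a = star v * a * v + T a := by
    intro a
    rw [compression_apply, Fintype.sum_option]
    simp [z', γ', T, compression_apply]
  let ψ := averagedCompression α hα z' γ'
  have hψ1 : ∀ a, ‖ψ a‖ ≤ ‖a‖ := fun a =>
    (norm_average_le hα _).trans (norm_compression_le α z' γ' (by rw [hsum]; exact hv1) a)
  have hT1 : ∀ a, ‖T a‖ ≤ ‖a‖ := norm_compression_le α z _ hz1
  -- The extra column contributes `‖v‖² ‖a‖ ≤ 3δR`, averaging contributes `4δ`.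
  have hψT : ∀ a ∈ F', ‖(ψ a : A) - T a‖ ≤ 7 * R * δ := by
    intro a ha
    have h1 : (ψ a : A) - T a =
        (average α hα (star v * a * v) : A) + ((average α hα (T a) : A) - T a) := by
      have h2 : ψ a = average α hα (star v * a * v) + average α hα (T a) := by
        rw [← map_add, ← hT']; rfl
      rw [h2, NonUnitalStarSubalgebra.coe_add, add_sub_assoc]
    have h3 : ‖average α hα (star v * a * v)‖ ≤ 3 * δ * R := by
      refine (norm_average_le hα _).trans ((norm_mul_le _ _).trans ?_)
      have h4 := norm_mul_le (star v) a
      rw [norm_star] at h4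
      calc ‖star v * a‖ * ‖v‖ ≤ ‖v‖ * ‖a‖ * ‖v‖ := by gcongr
        _ = ‖v‖ * ‖v‖ * ‖a‖ := by ring
        _ ≤ 3 * δ * R := by gcongr; exact hRF a ha
    rw [h1]
    refine (norm_add_le _ _).trans ?_
    have h5 : ‖(average α hα (star v * a * v) : A)‖ ≤ 3 * δ * R := h3
    have h6 := hinv a ha
    have h7 : δ ≤ R * δ := by nlinarith
    have h8 : ‖(average α hα (T a) : A) - T a‖ ≤ 4 * δ := h6
    linarith
  have hRδ : δ ≤ R * δ := by nlinarith
  have hRδ' : R * δ ≤ R ^ 2 * δ := by nlinarith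
  refine ⟨ψ, hψ1, ?_, ?_, ?_⟩
  · intro a ha b hb
    have h1 : ((ψ (a * b) : A) - ψ a * ψ b) = ((ψ (a * b) : A) - T (a * b)) +
        (T (a * b) - T a * T b) - (((ψ a : A) - T a) * T b + ψ a * ((ψ b : A) - T b)) := by
      rw [sub_mul, mul_sub]; abel
    have hb1 : ‖T b‖ ≤ R := (hT1 b).trans (hRF b (hFF' b hb))
    have ha1 : ‖(ψ a : A)‖ ≤ R := (hψ1 a).trans (hRF a (hFF' a ha))
    have h2 : ‖((ψ a : A) - T a) * T b‖ ≤ 7 * R * δ * R :=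
      (norm_mul_le _ _).trans (by gcongr; exact hψT a (hFF' a ha))
    have h3 : ‖(ψ a : A) * ((ψ b : A) - T b)‖ ≤ R * (7 * R * δ) :=
      (norm_mul_le _ _).trans (by gcongr; exact hψT b (hFF' b hb))
    have h4 : ‖T (a * b) - T a * T b‖ ≤ 5 * R * δ := hmul a (hFF' a ha) b (hFF' b hb)
    have h5 := hψT (a * b) (hmF' a ha b hb)
    have h6 : ‖(ψ (a * b) : A) - ψ a * ψ b‖ < ε := by
      rw [h1]
      refine (norm_sub_le _ _).trans_lt ?_
      have h7 := norm_add_le ((ψ (a * b) : A) - T (a * b)) (T (a * b) - T a * T b)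
      have h8 := norm_add_le (((ψ a : A) - T a) * T b) ((ψ a : A) * ((ψ b : A) - T b))
      nlinarith
    exact h6
  · intro a ha haf
    have h1 : (ψ a : A) - a = ((ψ a : A) - T a) + (T a - a) := by abel
    rw [h1]
    refine (norm_add_le _ _).trans_lt ?_
    have h2 : ‖T a - a‖ ≤ 3 * δ := hfix a (hFF' a ha) haf
    nlinarith [hψT a (hFF' a ha)]
  · intro u hu
    have h1 : compression α z' γ' u = u := by
      conv_rhs => rw [← hvu u hu, ← hsum]
      rw [compression_apply]
      refine Finset.sum_congr rfl fun o _ => ?_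
      rw [hu.mem_fixedPoints α, (hu _).2]
    show (average α hα (compression α z' γ' u) : A) = u
    rw [h1, average_of_mem hα (hu.mem_fixedPoints α)]

end Retractions

/-- Contractivity transfers approximate multiplicativity to nearby elements: each of the four
correction terms is at most `R * η`. -/
theorem norm_map_mul_sub_lt_of_close {A B : Type*} [NonUnitalCStarAlgebra A]
    [NonUnitalCStarAlgebra B] (ψ : A →ₗ[ℂ] B) (hψ : ∀ a, ‖ψ a‖ ≤ ‖a‖) {a a' b b' : A} {R η ε : ℝ}
    (ha : ‖a'‖ ≤ R) (hb : ‖b‖ ≤ R) (haa' : ‖a - a'‖ ≤ η) (hbb' : ‖b - b'‖ ≤ η)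
    (h : ‖ψ (a' * b') - ψ a' * ψ b'‖ < ε) :
    ‖ψ (a * b) - ψ a * ψ b‖ < ε + 4 * (R * η) := by
  have h1 : ψ (a * b) - ψ a * ψ b = (ψ (a' * b') - ψ a' * ψ b') +
      (ψ ((a - a') * b) + ψ (a' * (b - b')) -
        (ψ (a - a') * ψ b + ψ a' * ψ (b - b'))) := by
    simp only [sub_mul, mul_sub, map_sub]; abel
  have hη : 0 ≤ η := (norm_nonneg _).trans haa'
  have hR : 0 ≤ R := (norm_nonneg _).trans hb
  have h2 : ‖(a - a') * b‖ ≤ η * R := (norm_mul_le _ _).trans (by gcongr)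
  have h3 : ‖a' * (b - b')‖ ≤ R * η := (norm_mul_le _ _).trans (by gcongr)
  have h4 : ‖ψ (a - a') * ψ b‖ ≤ η * R := (norm_mul_le _ _).trans
    (mul_le_mul ((hψ _).trans haa') ((hψ _).trans hb) (norm_nonneg _) hη)
  have h5 : ‖ψ a' * ψ (b - b')‖ ≤ R * η := (norm_mul_le _ _).trans
    (mul_le_mul ((hψ _).trans ha) ((hψ _).trans hbb') (norm_nonneg _) hR)
  rw [h1]
  refine (norm_add_le _ _).trans_lt ?_
  have h6 := norm_sub_le (ψ ((a - a') * b) + ψ (a' * (b - b')))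
    (ψ (a - a') * ψ b + ψ a' * ψ (b - b'))
  have h7 := norm_add_le (ψ ((a - a') * b)) (ψ (a' * (b - b')))
  have h8 := norm_add_le (ψ (a - a') * ψ b) (ψ a' * ψ (b - b'))
  linarith [hψ ((a - a') * b), hψ (a' * (b - b'))]

theorem exists_finset_net {X : Type*} [PseudoMetricSpace X] {K : Set X} (hK : IsCompact K) {η : ℝ}
    (hη : 0 < η) : ∃ N : Finset X, ∀ x ∈ K, ∃ y ∈ N, dist x y ≤ η := by
  obtain ⟨N, -, hN, hKN⟩ := hK.finite_cover_balls hη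
  refine ⟨hN.toFinset, fun x hx => ?_⟩
  obtain ⟨y, hy, hxy⟩ := Set.mem_iUnion₂.1 (hKN hx)
  exact ⟨y, hN.mem_toFinset.2 hy, (Metric.mem_ball.1 hxy).le⟩

/-! ### Compact sets and the separable case. -/

section Main

variable {G : Type*} [Group G] [TopologicalSpace G] [IsTopologicalGroup G] [CompactSpace G]
variable {A : Type*} [NonUnitalCStarAlgebra A] [PartialOrder A] [StarOrderedRing A]

theorem exists_approximate_retraction (hA : IsSigmaUnital A) {α : G →* (A ≃⋆ₐ[ℂ] A)}
    (hα : ∀ a : A, Continuous fun g => α g a) (hR : HasRokhlinProperty α)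
    {F₁ : Set A} {F₂ : Set (fixedPoints α)} {ε : ℝ} (hF₁ : IsCompact F₁) (hF₂ : IsCompact F₂)
    (hε : 0 < ε) :
    ∃ ψ : A →CP fixedPoints α, (∀ a, ‖ψ a‖ ≤ ‖a‖) ∧
      (∀ a ∈ F₁, ∀ b ∈ F₁, ‖ψ (a * b) - ψ a * ψ b‖ < ε) ∧
      (∀ a ∈ F₂, ‖ψ (a : A) - a‖ < ε) ∧
      ∀ u : A, IsIdentity u → (ψ u : A) = u := by
  classical
  borelize G
  obtain ⟨C, hC⟩ := hF₁.isBounded.exists_norm_le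
  -- The net points are not required to lie in `F₁`; with `η ≤ 1` those used are bounded by `|C| +
  -- 1`. The correction `4 (|C| + 1) η` then fits in the remaining `ε / 2`.
  obtain ⟨η, hη, hη1, hηε⟩ : ∃ η : ℝ, 0 < η ∧ η ≤ 1 ∧ 8 * ((|C| + 1) * η) ≤ ε := by
    refine ⟨min 1 (ε / (8 * (|C| + 1))), lt_min one_pos (by positivity), min_le_left _ _, ?_⟩
    have h : 8 * (|C| + 1) * (ε / (8 * (|C| + 1))) = ε := by field_simp
    nlinarith [min_le_right 1 (ε / (8 * (|C| + 1))), abs_nonneg C]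
  obtain ⟨N₁, hN₁⟩ := exists_finset_net hF₁ hη
  obtain ⟨N₂, hN₂⟩ := exists_finset_net hF₂ hη
  obtain ⟨ψ, hψ, hmul, hfix, hu⟩ := exists_approximate_retraction_finset hA hα hR
    (N₁ ∪ N₂.image Subtype.val) (half_pos hε)
  refine ⟨ψ, hψ, fun a ha b hb => ?_, fun a ha => ?_, hu⟩
  · obtain ⟨a', ha', haa'⟩ := hN₁ a ha
    obtain ⟨b', hb', hbb'⟩ := hN₁ b hb
    rw [dist_eq_norm] at haa' hbb'
    have h1 : ‖a'‖ ≤ |C| + 1 := by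
      have h2 := norm_sub_norm_le a' a
      rw [norm_sub_rev] at h2
      linarith [hC a ha, le_abs_self C]
    have h3 := norm_map_mul_sub_lt_of_close ψ.toLinearMap hψ h1
      ((hC b hb).trans (by linarith [le_abs_self C])) haa' hbb'
      (hmul a' (Finset.mem_union_left _ ha') b' (Finset.mem_union_left _ hb'))
    refine lt_of_lt_of_le h3 ?_
    linarith
  · obtain ⟨a', ha', haa'⟩ := hN₂ a ha
    have h1 : ‖ψ (a' : A) - a'‖ < ε / 2 :=
      hfix a' (Finset.mem_union_right _ (Finset.mem_image_of_mem _ ha')) a'.2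
    rw [dist_eq_norm] at haa'
    have h2 : ψ (a : A) - a = (ψ (a' : A) - a') + (ψ ((a : A) - a') - (a - a')) := by
      rw [map_sub]; abel
    have h3 : ‖ψ ((a : A) - a')‖ ≤ η := (hψ _).trans haa'
    have h4 : η ≤ (|C| + 1) * η := by nlinarith [abs_nonneg C]
    rw [h2]
    refine (norm_add_le _ _).trans_lt ?_
    linarith [norm_sub_le (ψ ((a : A) - a')) (a - a')]

/-- The `n`-th map has tolerance `1 / (n + 1)` on the first `n + 1` terms of dense sequences in `A`
and in the fixed point algebra; contractivity extends the limits to all elements. -/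
theorem exists_approximate_retraction_seq (hA : IsSigmaUnital A) {α : G →* (A ≃⋆ₐ[ℂ] A)}
    (hα : ∀ a : A, Continuous fun g => α g a) (hR : HasRokhlinProperty α)
    [TopologicalSpace.SeparableSpace A] :
    ∃ ψ : ℕ → (A →CP fixedPoints α),
      IsApproximateHom (fun n => (ψ n).toLinearMap) ∧ (∀ n a, ‖ψ n a‖ ≤ ‖a‖) ∧
      (∀ n, ∀ u : A, IsIdentity u → (ψ n u : A) = u) ∧
      ∀ a : fixedPoints α, Tendsto (fun n => ‖ψ n (a : A) - a‖) atTop (𝓝 0) := by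
  classical
  have hsc : SecondCountableTopology A := UniformSpace.secondCountable_of_separable A
  let d : ℕ → A := TopologicalSpace.denseSeq A
  let d' : ℕ → fixedPoints α := TopologicalSpace.denseSeq (fixedPoints α)
  have hd : DenseRange d := TopologicalSpace.denseRange_denseSeq A
  have hd' : DenseRange d' := TopologicalSpace.denseRange_denseSeq (fixedPoints α)
  have hex (n : ℕ) := exists_approximate_retraction hA hα hR
    (((Finset.range (n + 1)).image d).finite_toSet.isCompact)
    (((Finset.range (n + 1)).image d').finite_toSet.isCompact)
    (Nat.one_div_pos_of_nat (α := ℝ) (n := n))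
  choose ψ hψ hmul hfix hu using hex
  have hev : ∀ k : ℕ, ∀ᶠ n in atTop, k ∈ Finset.range (n + 1) := fun k => by
    filter_upwards [eventually_ge_atTop k] with n hn
    exact Finset.mem_range.2 (Nat.lt_succ_of_le hn)
  have hsmall : ∀ ε : ℝ, 0 < ε → ∀ᶠ n : ℕ in atTop, 1 / ((n : ℝ) + 1) < ε := fun ε hε =>
    tendsto_one_div_add_atTop_nhds_zero_nat.eventually (gt_mem_nhds hε)
  refine ⟨ψ, ⟨fun a b => ?_, fun a => ?_⟩, hψ, hu, fun a => ?_⟩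
  · rw [Metric.tendsto_nhds]
    intro ε hε
    set R := ‖a‖ + ‖b‖ + 1 with hRdef
    have hR0 : 0 < R := by positivity
    obtain ⟨η, hη, hη1, hηε⟩ : ∃ η : ℝ, 0 < η ∧ η ≤ 1 ∧ 8 * (R * η) ≤ ε := by
      refine ⟨min 1 (ε / (8 * R)), lt_min one_pos (by positivity), min_le_left _ _, ?_⟩
      have h : 8 * R * (ε / (8 * R)) = ε := by field_simp
      nlinarith [min_le_right 1 (ε / (8 * R))]
    obtain ⟨k, hk⟩ := hd.exists_dist_lt a hη
    obtain ⟨l, hl⟩ := hd.exists_dist_lt b hη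
    rw [dist_eq_norm] at hk hl
    filter_upwards [hev k, hev l, hsmall (ε / 2) (half_pos hε)] with n hkn hln hn
    rw [Real.dist_eq, sub_zero, abs_of_nonneg (norm_nonneg _)]
    have h1 : ‖d k‖ ≤ R := by
      have h2 := norm_sub_norm_le (d k) a
      rw [norm_sub_rev] at h2
      linarith [norm_nonneg b]
    have h3 := norm_map_mul_sub_lt_of_close (ψ n).toLinearMap (hψ n) h1
      (by linarith [norm_nonneg a] : ‖b‖ ≤ R) hk.le hl.le
      ((hmul n (d k) (Finset.mem_coe.2 (Finset.mem_image_of_mem d hkn)) (d l)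
        (Finset.mem_coe.2 (Finset.mem_image_of_mem d hln))).trans hn)
    refine lt_of_lt_of_le h3 ?_
    linarith
  -- Completely positive maps preserve adjoints exactly, so this defect is identically zero.
  · have h : ∀ n, (ψ n).toLinearMap (star a) = star ((ψ n).toLinearMap a) := fun n =>
      map_star (ψ n) a
    simp [h]
  · rw [Metric.tendsto_nhds]
    intro ε hε
    obtain ⟨k, hk⟩ := hd'.exists_dist_lt a (by positivity : 0 < ε / 4)
    rw [dist_eq_norm] at hk
    filter_upwards [hev k, hsmall (ε / 2) (half_pos hε)] with n hkn hn
    rw [Real.dist_eq, sub_zero, abs_of_nonneg (norm_nonneg _)]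
    have h1 := hfix n (d' k) (Finset.mem_coe.2 (Finset.mem_image_of_mem d' hkn))
    have h2 : ψ n (a : A) - a =
        (ψ n (d' k : A) - d' k) + (ψ n ((a : A) - d' k) - (a - d' k)) := by
      rw [map_sub]; abel
    have h3 : ‖ψ n ((a : A) - d' k)‖ ≤ ‖a - d' k‖ := hψ n _
    rw [h2]
    refine (norm_add_le _ _).trans_lt ?_
    linarith [norm_sub_le (ψ n ((a : A) - d' k)) (a - d' k)]

end Main

end RokhlinAction

theorem mainTheorem1 {G : Type*} [Group G] [TopologicalSpace G] [IsTopologicalGroup G]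
    [CompactSpace G] [T2Space G] [SecondCountableTopology G]
    {A : Type*} [NonUnitalCStarAlgebra A] [PartialOrder A] [StarOrderedRing A]
    (hA : RokhlinAction.IsSigmaUnital A)
    (α : G →* (A ≃⋆ₐ[ℂ] A)) (hα : ∀ a : A, Continuous fun g => α g a)
    (hR : RokhlinAction.HasRokhlinProperty α) :
    (∀ (F₁ : Set A) (F₂ : Set (RokhlinAction.fixedPoints α)) (ε : ℝ),
      IsCompact F₁ → IsCompact F₂ → 0 < ε →
      ∃ ψ : A →CP RokhlinAction.fixedPoints α,
        (∀ a, ‖ψ a‖ ≤ ‖a‖) ∧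
        (∀ a ∈ F₁, ∀ b ∈ F₁, ‖ψ (a * b) - ψ a * ψ b‖ < ε) ∧
        (∀ a ∈ F₂, ‖ψ (a : A) - a‖ < ε) ∧
        (∀ u : A, RokhlinAction.IsIdentity u → (ψ u : A) = u)) ∧
    (TopologicalSpace.SeparableSpace A →
      ∃ ψ : ℕ → (A →CP RokhlinAction.fixedPoints α),
        RokhlinAction.IsApproximateHom (fun n => (ψ n).toLinearMap) ∧
        (∀ n a, ‖ψ n a‖ ≤ ‖a‖) ∧
        (∀ n, ∀ u : A, RokhlinAction.IsIdentity u → (ψ n u : A) = u) ∧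
        (∀ a : RokhlinAction.fixedPoints α,
          Tendsto (fun n => ‖ψ n (a : A) - a‖) atTop (𝓝 0))) :=
  ⟨fun _ _ _ hF₁ hF₂ hε => RokhlinAction.exists_approximate_retraction hA hα hR hF₁ hF₂ hε,
    fun _ => RokhlinAction.exists_approximate_retraction_seq hA hα hR⟩
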